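/- Let $\mathbb X,\mathbb Y$ be locally compact Polish spaces with locally finite positive measures $\lambda,\nu$, let $U:\mathbb X\to\mathbb R$, $V:\mathbb Y\to\mathbb R$, $W:\mathbb X\times\mathbb Y\to\mathbb R$ be measurable, and suppose that $\lambda_U(dx):=e^{-U(x)}\lambda(dx)$ and $\nu_V(dy):=e^{-V(y)}\nu(dy)$ are probability measures and that $\mathcal Q(x,dy):=e^{-W(x,y)}\nu(dy)$ is a Markov kernel. Let $\mathcal P_0(d(x,y)):=\lambda_U(dx)\,\mathcal Q(x,dy)$. The Sinkhorn transitions $\mathcal S_n$, bridges $\mathcal P_n$ and marginals $\pi_n$ are defined by $\mathcal S_0=\mathcal Q$ and, for $n\ge 0$, $$\mathcal P_{2n}(d(x,y))=\lambda_U(dx)\,\mathcal S_{2n}(x,dy)=\pi_{2n}(dy)\,\mathcal S_{2n+1}(y,dx),\qquad \pi_{2n}:=\lambda_U\mathcal S_{2n},$$ $$\mathcal P_{2n+1}(d(x,y))=\nu_V(dy)\,\mathcal S_{2n+1}(y,dx)=\pi_{2n+1}(dx)\,\mathcal S_{2n+2}(x,dy),\qquad \pi_{2n+1}:=\nu_V\mathcal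 S_{2n+1}.$$ For a convex function $\Phi:\mathbb R_+^2\to\mathbb R\cup\{+\infty\}$ with $\Phi(au,av)=a\,\Phi(u,v)$ for all $a\in\mathbb R_+$ and $\Phi(1,1)=0$, the $\Phi$-entropy of two probability measures is $D_\Phi(\nu_1,\nu_2):=\int\Phi\big(\tfrac{d\nu_1}{d\gamma},\tfrac{d\nu_2}{d\gamma}\big)\,d\gamma\in(-\infty,+\infty]$, for any dominating measure $\gamma$. Let $\mathrm{Ent}(\mathcal P\,|\,\mathcal P'):=\int\log\tfrac{d\mathcal P}{d\mathcal P'}\,d\mathcal P$ be the relative entropy ($+\infty$ if $\mathcal P\not\ll\mathcal P'$), and let $\|\cdot\|$ be the (essential) supremum norm. **Theorem.** Assume that $W$ is uniformly bounded. Then for every such $\Phi$ there are $\rho\in\,]0,1[$ and $c>0$ such that the following hold. 1. For all $n\ge 0$, $$D_\Phi(\pi_{2n},\nu_V)\le\rho^n D_\Phi(\pi_0,\nu_V),\qquad D_\Phi(\nu_V,\pi_{2n})\le\rho^n D_\Phi(\nu_V,\pi_0),$$ $$D_\Phi(\lambda_U,\pi_{2n+1})\le\rho^n D_\Phi(\lambda_U,\pi_1),\qquad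 D_\Phi(\pi_{2n+1},\lambda_U)\le\rho^n D_\Phi(\pi_1,\lambda_U).$$ 2. For all $n\ge 1$, and also for $n=0$ if $V$ is bounded ($\nu$-almost everywhere), $\pi_{2n}$ and $\nu_V$ are mutually absolutely continuous, and $$\Big\|\log\frac{d\pi_{2n}}{d\nu_V}\Big\|\le c\,\rho^n,\qquad \Big\|\log\frac{d\nu_V}{d\pi_{2n}}\Big\|\le c\,\rho^n.$$ 3. For all $n\ge 0$, $\lambda_U$ and $\pi_{2n+1}$ are mutually absolutely continuous, and $$\Big\|\log\frac{d\lambda_U}{d\pi_{2n+1}}\Big\|\le c\,\rho^n,\qquad \Big\|\log\frac{d\pi_{2n+1}}{d\lambda_U}\Big\|\le c\,\rho^n.$$ 4. If some coupling $\mathcal P$ of $\lambda_U$ and $\nu_V$ satisfies $\mathrm{Ent}(\mathcal P\,|\,\mathcal P_0)<\infty$, then the minimizer $\mathbb P$ of $\mathrm{Ent}(\,\cdot\,|\,\mathcal P_0)$ over the couplings of $\lambda_U$ and $\nu_V$ (the Schrödinger bridge) exists and is unique, and $$\mathrm{Ent}(\mathbb P\,|\,\mathcal P_{2n})\le c\,\rho^n\qquad\text{for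 all } n\ge 0.$$ -/

import Mathlib

open MeasureTheory ProbabilityTheory
open scoped ENNReal NNReal

namespace Sinkhorn

noncomputable section

/-! ### Convex homogeneous functions and the associated entropies -/

/-- `Φ : ℝ₊ × ℝ₊ → ℝ ∪ {+∞}` is jointly convex, positively homogeneous and `Φ (1, 1) = 0`.
Products in `EReal` follow the convention `0 * ∞ = 0`. -/
structure IsEntropyFunction (Φ : ℝ≥0 → ℝ≥0 → EReal) : Prop where
  ne_bot : ∀ u v, Φ u v ≠ ⊥
  convex : ∀ (a b u₁ v₁ u₂ v₂ : ℝ≥0), a + b = 1 →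
    Φ (a * u₁ + b * u₂) (a * v₁ + b * v₂) ≤
      ((a : ℝ) : EReal) * Φ u₁ v₁ + ((b : ℝ) : EReal) * Φ u₂ v₂
  homogeneous : ∀ a u v : ℝ≥0, Φ (a * u) (a * v) = ((a : ℝ) : EReal) * Φ u v
  map_one_one : Φ 1 1 = 0

/-- Integral of an extended real valued function: integral of the positive part minus integral
of the negative part. -/
def erealIntegral {S : Type*} [MeasurableSpace S] (γ : Measure S) (f : S → EReal) : EReal :=
  ((∫⁻ x, (f x).toENNReal ∂γ : ℝ≥0∞) : EReal) - ((∫⁻ x, (-f x).toENNReal ∂γ : ℝ≥0∞) : EReal)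

/-- The integral `∫ Φ(dμ/dγ, dη/dγ) dγ`, for a dominating measure `γ`. -/
def phiEntropyWrt {S : Type*} [MeasurableSpace S] (Φ : ℝ≥0 → ℝ≥0 → EReal)
    (γ μ η : Measure S) : EReal :=
  erealIntegral γ fun x => Φ (μ.rnDeriv γ x).toNNReal (η.rnDeriv γ x).toNNReal

/-- The `Φ`-entropy `D_Φ(μ, η)`, computed with the dominating measure `γ = μ + η`.
By `phiEntropy_eq_phiEntropyWrt` any other σ-finite dominating measure gives the same value. -/
def phiEntropy {S : Type*} [MeasurableSpace S] (Φ : ℝ≥0 → ℝ≥0 → EReal)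
    (μ η : Measure S) : EReal :=
  phiEntropyWrt Φ (μ + η) μ η

theorem toENNReal_coe_mul (a : ℝ≥0) (x : EReal) :
    (((a : ℝ) : EReal) * x).toENNReal = (a : ℝ≥0∞) * x.toENNReal := by
  rw [EReal.toENNReal_mul (by exact_mod_cast a.2)]
  simp

theorem erealIntegral_rnDeriv {S : Type*} [MeasurableSpace S] (γ m : Measure S) [SigmaFinite γ]
    [SigmaFinite m] (hm : m ≪ γ) (f : S → EReal) :
    erealIntegral m f =
      erealIntegral γ fun x => (((m.rnDeriv γ x).toNNReal : ℝ) : EReal) * f x := by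
  have key : ∀ g : S → ℝ≥0∞,
      ∫⁻ x, g x ∂m = ∫⁻ x, ((m.rnDeriv γ x).toNNReal : ℝ≥0∞) * g x ∂γ := by
    intro g
    conv_lhs => rw [← Measure.withDensity_rnDeriv_eq m γ hm]
    rw [lintegral_withDensity_eq_lintegral_mul_non_measurable γ (Measure.measurable_rnDeriv m γ)
      (Measure.rnDeriv_lt_top m γ)]
    refine lintegral_congr_ae ?_
    filter_upwards [Measure.rnDeriv_lt_top m γ] with x hx
    simp [ENNReal.coe_toNNReal hx.ne]
  unfold erealIntegral
  rw [key, key]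
  congr 3
  · funext x
    exact (toENNReal_coe_mul _ _).symm
  · funext x
    rw [← mul_neg]
    exact (toENNReal_coe_mul _ _).symm

/-- The `Φ`-entropy does not depend on the dominating measure. -/
theorem phiEntropy_eq_phiEntropyWrt {S : Type*} [MeasurableSpace S]
    {Φ : ℝ≥0 → ℝ≥0 → EReal} (hΦ : IsEntropyFunction Φ) (γ μ η : Measure S) [SigmaFinite γ]
    [IsProbabilityMeasure μ] [IsProbabilityMeasure η] (hμ : μ ≪ γ) (hη : η ≪ γ) :
    phiEntropy Φ μ η = phiEntropyWrt Φ γ μ η := by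
  have hm : μ + η ≪ γ := hμ.add_left hη
  have h1 : μ.rnDeriv (μ + η) * (μ + η).rnDeriv γ =ᵐ[γ] μ.rnDeriv γ :=
    Measure.rnDeriv_mul_rnDeriv (Measure.AbsolutelyContinuous.rfl.add_right η)
  have h2 : η.rnDeriv (μ + η) * (μ + η).rnDeriv γ =ᵐ[γ] η.rnDeriv γ :=
    Measure.rnDeriv_mul_rnDeriv (Measure.AbsolutelyContinuous.rfl.add_right' μ)
  unfold phiEntropy phiEntropyWrt
  rw [erealIntegral_rnDeriv γ (μ + η) hm]
  have h3 : (fun x => ((((μ + η).rnDeriv γ x).toNNReal : ℝ) : EReal) *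
        Φ (μ.rnDeriv (μ + η) x).toNNReal (η.rnDeriv (μ + η) x).toNNReal) =ᵐ[γ]
      fun x => Φ (μ.rnDeriv γ x).toNNReal (η.rnDeriv γ x).toNNReal := by
    filter_upwards [h1, h2] with x hx1 hx2
    rw [← hΦ.homogeneous, ← hx1, ← hx2, Pi.mul_apply, Pi.mul_apply, ENNReal.toNNReal_mul,
      ENNReal.toNNReal_mul, mul_comm (ENNReal.toNNReal ((μ + η).rnDeriv γ x)),
      mul_comm (ENNReal.toNNReal ((μ + η).rnDeriv γ x))]
  have h4 : ∀ g : EReal → ℝ≥0∞,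
      ∫⁻ x, g ((((μ + η).rnDeriv γ x).toNNReal : ℝ) *
        Φ (μ.rnDeriv (μ + η) x).toNNReal (η.rnDeriv (μ + η) x).toNNReal) ∂γ =
      ∫⁻ x, g (Φ (μ.rnDeriv γ x).toNNReal (η.rnDeriv γ x).toNNReal) ∂γ :=
    fun g => lintegral_congr_ae (h3.mono fun x hx => congrArg g hx)
  unfold erealIntegral
  exact congrArg₂ (fun p q : ℝ≥0∞ => (p : EReal) - (q : EReal)) (h4 EReal.toENNReal)
    (h4 fun z => (-z).toENNReal)

/-! ### Logarithm of Radon-Nikodym derivatives -/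

/-- `dμ/dη` exists and `‖log (dμ/dη)‖ ≤ b`, where the norm is the (`η`-essential) supremum norm,
the logarithm takes the values `log 0 = -∞`, `log ∞ = ∞` and the absolute values of these are
`∞`. -/
def LogDensityBound {S : Type*} [MeasurableSpace S] (μ η : Measure S) (b : ℝ) : Prop :=
  μ ≪ η ∧ essSup (fun y => (ENNReal.log (μ.rnDeriv η y)).abs) η ≤ ENNReal.ofReal b

/-! ### Reference model -/

/-- The Gibbs measure `λ_U(dx) = e^{-U(x)} λ(dx)`. -/
def gibbs {S : Type*} [MeasurableSpace S] (lam : Measure S) (U : S → ℝ) : Measure S :=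
  lam.withDensity fun x => ENNReal.ofReal (Real.exp (-U x))

/-- The reference kernel `𝒬(x, dy) = e^{-W(x,y)} ν(dy)` (for a jointly measurable `W`). -/
def refKernel {X Y : Type*} [MeasurableSpace X] [MeasurableSpace Y] (nu : Measure Y)
    [SFinite nu] (W : X → Y → ℝ) : Kernel X Y :=
  (Kernel.const X nu).withDensity fun x y => ENNReal.ofReal (Real.exp (-W x y))

/-! ### Sinkhorn iterations -/

section Iterations

variable {X Y : Type*} [MeasurableSpace X] [StandardBorelSpace X] [Nonempty X]
  [MeasurableSpace Y] [StandardBorelSpace Y] [Nonempty Y]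
  (μ : Measure X) [IsProbabilityMeasure μ] (η : Measure Y) [IsProbabilityMeasure η]
  (Q : Kernel X Y) [IsMarkovKernel Q]

/-- The transitions `𝒮_{2n}`, bundled with the fact that they are Markov. Here `posterior κ μ` is
the conditional law of `x` given `y` under the law `μ(dx) κ(x, dy)`. -/
def evenAux : ℕ → {κ : Kernel X Y // IsMarkovKernel κ}
  | 0 => ⟨Q, inferInstance⟩
  | n + 1 =>
    haveI : IsMarkovKernel (evenAux n).1 := (evenAux n).2
    ⟨posterior (posterior (evenAux n).1 μ) η, inferInstance⟩

/-- `evenKernel μ η Q n` is the Sinkhorn transition `𝒮_{2n}` from `X` to `Y`, for the marginals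
`μ` and `η` and the reference transition `𝒮_0 = Q`. -/
def evenKernel (n : ℕ) : Kernel X Y := (evenAux μ η Q n).1

instance (n : ℕ) : IsMarkovKernel (evenKernel μ η Q n) := (evenAux μ η Q n).2

/-- `oddKernel μ η Q n` is the Sinkhorn transition `𝒮_{2n+1}` from `Y` to `X`. -/
def oddKernel (n : ℕ) : Kernel Y X := posterior (evenKernel μ η Q n) μ

instance (n : ℕ) : IsMarkovKernel (oddKernel μ η Q n) := by
  unfold oddKernel; infer_instance

/-- The distribution `π_{2n} = μ 𝒮_{2n}` on `Y`. -/
def piEven (n : ℕ) : Measure Y := μ.bind (evenKernel μ η Q n)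

/-- The distribution `π_{2n+1} = η 𝒮_{2n+1}` on `X`. -/
def piOdd (n : ℕ) : Measure X := η.bind (oddKernel μ η Q n)

/-- The Sinkhorn bridge `𝒫_{2n}(d(x,y)) = μ(dx) 𝒮_{2n}(x, dy)`. -/
def bridgeEven (n : ℕ) : Measure (X × Y) := μ ⊗ₘ evenKernel μ η Q n

/-- The Sinkhorn bridge `𝒫_{2n+1}(d(x,y)) = η(dy) 𝒮_{2n+1}(y, dx)`. -/
def bridgeOdd (n : ℕ) : Measure (X × Y) := (η ⊗ₘ oddKernel μ η Q n).map Prod.swap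

theorem evenKernel_zero : evenKernel μ η Q 0 = Q := rfl

/-- `(π_{2n} × 𝒮_{2n+1})^♭ = 𝒫_{2n}`. -/
theorem piEven_compProd_oddKernel (n : ℕ) :
    (piEven μ η Q n ⊗ₘ oddKernel μ η Q n).map Prod.swap = bridgeEven μ η Q n := by
  unfold piEven oddKernel bridgeEven
  rw [compProd_posterior_eq_map_swap, Measure.map_map measurable_swap measurable_swap,
    Prod.swap_swap_eq, Measure.map_id]

/-- `π_{2n+1} × 𝒮_{2(n+1)} = 𝒫_{2n+1}`. -/
theorem piOdd_compProd_evenKernel (n : ℕ) :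
    piOdd μ η Q n ⊗ₘ evenKernel μ η Q (n + 1) = bridgeOdd μ η Q n :=
  compProd_posterior_eq_map_swap (κ := oddKernel μ η Q n) (μ := η)

end Iterations

/-! ### Schrödinger bridges -/

/-- The set of measures on `X × Y` with marginals `μ` and `η`. -/
def couplings {X Y : Type*} [MeasurableSpace X] [MeasurableSpace Y]
    (μ : Measure X) (η : Measure Y) : Set (Measure (X × Y)) :=
  {P | P.fst = μ ∧ P.snd = η}

/-- `P` minimizes the relative entropy `Ent(· | P₀)` over the couplings of `μ` and `η`. -/
def IsSchrodingerBridge {X Y : Type*} [MeasurableSpace X] [MeasurableSpace Y]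
    (μ : Measure X) (η : Measure Y) (P₀ P : Measure (X × Y)) : Prop :=
  P ∈ couplings μ η ∧
    ∀ P' ∈ couplings μ η, InformationTheory.klDiv P P₀ ≤ InformationTheory.klDiv P' P₀

end

end Sinkhorn

open Sinkhorn

/-! Write `w = e^{-W}`. With respect to `λ_U ⊗ ν_V` every Sinkhorn bridge has a density of product
form: `a_n(x) w(x,y) b_n(y)` for the even ones and `a_n(x) w(x,y) b_{n+1}(y)` for the odd ones, with
`b_0 = e^V` and each new potential the `normalizer` of the previous one (`bridges_eq`). Hence
`π_{2n} = (b_n / b_{n+1}) ν_V` and `π_{2n+1} = (a_n / a_{n+1}) λ_U`, and all claims concern ratios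
of consecutive potentials.

If `|W| ≤ C`, the values of `w` along rows and columns differ by a factor of at most `κ = e^{2C}`.
Normalizers inherit this, so the transition with density `b_{n+1}(y) w(x,y) a_n(x)` relative to
`λ_U` is bounded below by `κ⁻²`. Every half step therefore splits off a constant part of mass `κ⁻²`
and acts on a remainder of mass `δ = 1 - κ⁻²`; the rate is `ρ = δ²`, for two half steps.

This minorization is used twice. Convexity and homogeneity turn it into a contraction of all
`Φ`-entropies (`lintegral_shiftedEntropy_le`, `phiEntropy_half_step`): the transition carries the
pair `(π_{2n}, ν_V)` to `(λ_U, π_{2n+1})`. It also contracts the relative spread `R` of a ratio of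
potentials, `r(x) ≤ (1 + R) r(x')` (`normalizer_div_normalizer_le`). As the ratios have mean one,
small spread means small logarithm, which yields the log-density bounds.

The logarithms of the potentials then form geometric Cauchy sequences. Their limits solve the
Schrödinger system, so `P = a' w b'` is a coupling whose log-density relative to `𝒫_{2n}` is a
function of `x` plus a function of `y`. For such a `P` the Pythagorean identity
`klDiv_eq_add_of_log_density_split` gives minimality and uniqueness, and for `n ≥ 1` the uniform
bound on the log-density gives the rate. -/

namespace Sinkhorn
namespace IsEntropyFunction

/-! ### Convex analysis of entropy functions: linear minorants and measurability. -/

variable {Φ : ℝ≥0 → ℝ≥0 → EReal}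

theorem map_zero_zero (hΦ : IsEntropyFunction Φ) : Φ 0 0 = 0 := by
  simpa using hΦ.homogeneous 0 1 1

/-- Convexity at the midpoint of the doubled points, with the factors absorbed by homogeneity.
Convexity is used below in this form. -/
theorem map_add_le (hΦ : IsEntropyFunction Φ) (u₁ v₁ u₂ v₂ : ℝ≥0) :
    Φ (u₁ + u₂) (v₁ + v₂) ≤ Φ u₁ v₁ + Φ u₂ v₂ := by
  have half : ∀ u v : ℝ≥0, (((2⁻¹ : ℝ≥0) : ℝ) : EReal) * Φ (2 * u) (2 * v) = Φ u v := by
    intro u v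
    rw [← hΦ.homogeneous, inv_mul_cancel_left₀ two_ne_zero, inv_mul_cancel_left₀ two_ne_zero]
  have h := hΦ.convex 2⁻¹ 2⁻¹ (2 * u₁) (2 * v₁) (2 * u₂) (2 * v₂)
    (by rw [← two_mul]; exact mul_inv_cancel₀ two_ne_zero)
  rw [half, half] at h
  simpa only [inv_mul_cancel_left₀ (two_ne_zero (α := ℝ≥0))] using h

theorem swap (hΦ : IsEntropyFunction Φ) : IsEntropyFunction fun u v => Φ v u where
  ne_bot u v := hΦ.ne_bot v u
  convex a b u₁ v₁ u₂ v₂ h := hΦ.convex a b v₁ u₁ v₂ u₂ h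
  homogeneous a u v := hΦ.homogeneous a v u
  map_one_one := hΦ.map_one_one

theorem coe_toReal (hΦ : IsEntropyFunction Φ) {u v : ℝ≥0} (h : Φ u v ≠ ⊤) :
    (((Φ u v).toReal : ℝ) : EReal) = Φ u v :=
  EReal.coe_toReal h (hΦ.ne_bot u v)

/-- A conical combination of points at which `Φ` is finite. -/
theorem map_conic_le (hΦ : IsEntropyFunction Φ) (a b : ℝ≥0) {u₁ v₁ u₂ v₂ : ℝ≥0}
    (h₁ : Φ u₁ v₁ ≠ ⊤) (h₂ : Φ u₂ v₂ ≠ ⊤) :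
    Φ (a * u₁ + b * u₂) (a * v₁ + b * v₂) ≤
      ((a * (Φ u₁ v₁).toReal + b * (Φ u₂ v₂).toReal : ℝ) : EReal) := by
  refine (hΦ.map_add_le _ _ _ _).trans_eq ?_
  rw [hΦ.homogeneous, hΦ.homogeneous, EReal.coe_add, EReal.coe_mul, EReal.coe_mul,
    hΦ.coe_toReal h₁, hΦ.coe_toReal h₂]

/-- If `Φ` is finite somewhere on both sides of the ray through `(F, G)`, then `Φ` has a linear
minorant which is exact at `(F, G)`. -/
theorem exists_linear_minorant (hΦ : IsEntropyFunction Φ) {F G : ℝ≥0}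
    (h₁ : ∃ u v, v * F < u * G ∧ Φ u v ≠ ⊤) (h₂ : ∃ u v, u * G < v * F ∧ Φ u v ≠ ⊤) :
    ∃ α β : ℝ, (∀ u v : ℝ≥0, ((α * u + β * v : ℝ) : EReal) ≤ Φ u v) ∧
      Φ F G = ((α * F + β * G : ℝ) : EReal) := by
  -- Cramer's rule: `(F, G)` times the determinant is a conic combination of two points on opposite
  -- sides of its ray, which bounds `Φ F G` from above.
  have cross : ∀ {u₁ v₁ u₂ v₂ : ℝ≥0}, v₁ * F < u₁ * G → u₂ * G < v₂ * F → Φ u₁ v₁ ≠ ⊤ →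
      Φ u₂ v₂ ≠ ⊤ → 0 < (u₁ * v₂ - u₂ * v₁ : ℝ) ∧
      (((u₁ * v₂ - u₂ * v₁ : ℝ) : EReal) * Φ F G ≤
        (((v₂ * F - u₂ * G) * (Φ u₁ v₁).toReal + (u₁ * G - v₁ * F) * (Φ u₂ v₂).toReal : ℝ) :
          EReal)) := by
    intro u₁ v₁ u₂ v₂ hp hq fp fq
    have hp' : (v₁ * F : ℝ) < u₁ * G := by exact_mod_cast hp
    have hq' : (u₂ * G : ℝ) < v₂ * F := by exact_mod_cast hq
    have hG : (0 : ℝ) < G := pos_of_mul_pos_right (lt_of_le_of_lt (by positivity) hp') u₁.2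
    have hD : 0 < (u₁ * v₂ - u₂ * v₁ : ℝ) := by
      have hu : (0 : ℝ) < u₁ := pos_of_mul_pos_left (lt_of_le_of_lt (by positivity) hp') G.2
      have h0 : 0 < (u₁ * v₂ - u₂ * v₁ : ℝ) * F := by
        nlinarith [mul_pos (sub_pos.2 hq') hu, mul_nonneg (sub_pos.2 hp').le u₂.2]
      exact pos_of_mul_pos_left h0 F.2
    refine ⟨hD, ?_⟩
    obtain ⟨a, ha⟩ : ∃ a : ℝ≥0, (a : ℝ) = v₂ * F - u₂ * G := ⟨⟨_, (sub_pos.2 hq').le⟩, rfl⟩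
    obtain ⟨b, hb⟩ : ∃ b : ℝ≥0, (b : ℝ) = u₁ * G - v₁ * F := ⟨⟨_, (sub_pos.2 hp').le⟩, rfl⟩
    obtain ⟨d, hd⟩ : ∃ d : ℝ≥0, (d : ℝ) = u₁ * v₂ - u₂ * v₁ := ⟨⟨_, hD.le⟩, rfl⟩
    have key := hΦ.map_conic_le a b fp fq
    rw [← ha, ← hb, ← hd, ← hΦ.homogeneous]
    refine le_trans (le_of_eq ?_) key
    congr 1 <;> ext <;> push_cast <;> rw [ha, hb, hd] <;> ring
  obtain ⟨p₁, p₂, hp, fp⟩ := h₁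
  obtain ⟨q₁, q₂, hq, fq⟩ := h₂
  obtain ⟨hD, hfin⟩ := cross hp hq fp fq
  have hFG : Φ F G ≠ ⊤ := by
    intro htop
    rw [htop, EReal.coe_mul_top_of_pos hD] at hfin
    exact EReal.coe_ne_top _ (top_le_iff.1 hfin)
  have hG : (0 : ℝ) < G := by
    have hp' : (p₂ * F : ℝ) < p₁ * G := by exact_mod_cast hp
    exact pos_of_mul_pos_right (lt_of_le_of_lt (by positivity) hp') p₁.2
  have hF : (0 : ℝ) < F := by
    have hq' : (q₁ * G : ℝ) < q₂ * F := by exact_mod_cast hq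
    exact pos_of_mul_pos_right (lt_of_le_of_lt (by positivity) hq') q₂.2
  set r : ℝ := (Φ F G).toReal with hr
  have hrΦ : Φ F G = r := (hΦ.coe_toReal hFG).symm
  -- The linear functions with value `r` at `(F, G)` form a one-parameter family with slope `s`.
  -- Finite points on one side of the ray bound `s` from below, those on the other side from above,
  -- and `cross` says that these bounds are compatible.
  obtain ⟨s, hs₁, hs₂⟩ := exists_between_of_forall_le
    (s := {t : ℝ | ∃ u v : ℝ≥0, u * G < v * F ∧ Φ u v ≠ ⊤ ∧
      t = (v * r / G - (Φ u v).toReal) / (v * F - u * G)})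
    (t := {t : ℝ | ∃ u v : ℝ≥0, v * F < u * G ∧ Φ u v ≠ ⊤ ∧
      t = ((Φ u v).toReal - v * r / G) / (u * G - v * F)})
    ⟨_, q₁, q₂, hq, fq, rfl⟩ ⟨_, p₁, p₂, hp, fp, rfl⟩ (by
      rintro _ ⟨u₂, v₂, hq, fq, rfl⟩ _ ⟨u₁, v₁, hp, fp, rfl⟩
      obtain ⟨hD, hle⟩ := cross hp hq fp fq
      rw [hrΦ, ← EReal.coe_mul, EReal.coe_le_coe_iff] at hle
      have hp' : (v₁ * F : ℝ) < u₁ * G := by exact_mod_cast hp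
      have hq' : (u₂ * G : ℝ) < v₂ * F := by exact_mod_cast hq
      rw [div_le_div_iff₀ (sub_pos.2 hq') (sub_pos.2 hp')]
      have : (v₂ * r / G) * (u₁ * G - v₁ * F) + (v₁ * r / G) * (v₂ * F - u₂ * G) =
          (u₁ * v₂ - u₂ * v₁ : ℝ) * r := by
        field_simp; ring
      linarith)
  refine ⟨s * G, r / G - s * F, fun u v => ?_, ?_⟩
  · by_cases hf : Φ u v = ⊤
    · rw [hf]; exact le_top
    rw [← hΦ.coe_toReal hf, EReal.coe_le_coe_iff]
    rcases lt_trichotomy (v * F) (u * G) with h | h | h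
    · have h' : (v * F : ℝ) < u * G := by exact_mod_cast h
      have := hs₂ ⟨u, v, h, hf, rfl⟩
      rw [le_div_iff₀ (sub_pos.2 h')] at this
      have e : (v * r / G : ℝ) = r / G * v := by ring
      nlinarith
    · have h' : (v * F : ℝ) = u * G := by exact_mod_cast h
      have e := hΦ.homogeneous (v / G) F G
      have hG0 : G ≠ 0 := by rintro rfl; simp at hG
      rw [div_mul_cancel₀ _ hG0, div_mul_eq_mul_div, h, mul_div_cancel_right₀ _ hG0, hrΦ,
        ← EReal.coe_mul] at e
      rw [e, EReal.toReal_coe]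
      refine le_of_eq ?_
      push_cast
      field_simp
      linear_combination (-s * G) * h'
    · have h' : (u * G : ℝ) < v * F := by exact_mod_cast h
      have := hs₁ ⟨u, v, h, hf, rfl⟩
      rw [div_le_iff₀ (sub_pos.2 h')] at this
      have e : (v * r / G : ℝ) = r / G * v := by ring
      nlinarith
  · rw [hrΦ, EReal.coe_eq_coe_iff]
    field_simp
    ring

/-- An entropy function is bounded below by a linear function. -/
theorem exists_lower_bound (hΦ : IsEntropyFunction Φ) :
    ∃ A : ℝ≥0, ∀ u v : ℝ≥0, ((-(A * (u + v)) : ℝ) : EReal) ≤ Φ u v := by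
  have main : ∀ {Φ : ℝ≥0 → ℝ≥0 → EReal}, IsEntropyFunction Φ → (∃ u v, v < u ∧ Φ u v ≠ ⊤) →
      ∃ A : ℝ≥0, ∀ u v : ℝ≥0, ((-(A * (u + v)) : ℝ) : EReal) ≤ Φ u v := by
    rintro Φ hΦ ⟨u, v, huv, hf⟩
    -- The ray through `(u + 1, v + 1)` lies strictly between those through `(u, v)` and `(1, 1)`,
    -- and `Φ` is finite at both.
    obtain ⟨α, β, hl, -⟩ := hΦ.exists_linear_minorant (F := u + 1) (G := v + 1)
      ⟨u, v, by rw [mul_add, mul_add, mul_comm v u]; simpa using huv, hf⟩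
      ⟨1, 1, by simpa using huv, by rw [hΦ.map_one_one]; exact EReal.zero_ne_top⟩
    obtain ⟨A, hA⟩ : ∃ A : ℝ≥0, (A : ℝ) = max |α| |β| := ⟨⟨_, by positivity⟩, rfl⟩
    refine ⟨A, fun u v => (EReal.coe_le_coe_iff.2 ?_).trans (hl u v)⟩
    have h1 : -(max |α| |β|) ≤ α := neg_le.1 ((neg_le_abs α).trans (le_max_left _ _))
    have h2 : -(max |α| |β|) ≤ β := neg_le.1 ((neg_le_abs β).trans (le_max_right _ _))
    have := mul_le_mul_of_nonneg_right h1 u.2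
    have := mul_le_mul_of_nonneg_right h2 v.2
    simp only [NNReal.val_eq_coe] at *
    rw [hA]
    linarith
  by_cases h₁ : ∃ u v, v < u ∧ Φ u v ≠ ⊤
  · exact main hΦ h₁
  by_cases h₂ : ∃ u v, u < v ∧ Φ u v ≠ ⊤
  · obtain ⟨u, v, h⟩ := h₂
    obtain ⟨A, hA⟩ := main hΦ.swap ⟨v, u, h⟩
    exact ⟨A, fun u v => by simpa only [add_comm] using hA v u⟩
  -- In the remaining case `Φ` is infinite off the diagonal and zero on it.
  push Not at h₁ h₂
  refine ⟨0, fun u v => ?_⟩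
  rcases lt_trichotomy u v with h | rfl | h
  · rw [h₂ u v h]; exact le_top
  · have := hΦ.homogeneous u 1 1
    rw [hΦ.map_one_one] at this
    simp_all
  · rw [h₁ u v h]; exact le_top

/-- Sublevel sets of the convex section `t ↦ Φ t 1` are order-connected, hence measurable without
any continuity of `Φ`; homogeneity recovers `Φ` from this section and the value `Φ 1 0`. -/
theorem measurable_uncurry (hΦ : IsEntropyFunction Φ) :
    Measurable fun p : ℝ≥0 × ℝ≥0 => Φ p.1 p.2 := by
  have h1 : Measurable fun t : ℝ≥0 => Φ t 1 := by
    refine measurable_of_Iic fun c => Set.OrdConnected.measurableSet ⟨?_⟩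
    intro x hx y hy z hz
    rcases eq_or_lt_of_le (hz.1.trans hz.2) with rfl | hxy
    · rwa [← le_antisymm hz.1 hz.2]
    simp only [Set.mem_preimage, Set.mem_Iic] at hx hy ⊢
    by_cases hc : c = ⊤
    · rw [hc]; exact le_top
    have hd : (0 : ℝ) < y - x := sub_pos.2 (by exact_mod_cast hxy)
    have hz1 : (x : ℝ) ≤ z := by exact_mod_cast hz.1
    have hz2 : (z : ℝ) ≤ y := by exact_mod_cast hz.2
    obtain ⟨a, ha⟩ : ∃ a : ℝ≥0, (a : ℝ) = (y - z) / (y - x) :=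
      ⟨⟨_, div_nonneg (sub_nonneg.2 hz2) hd.le⟩, rfl⟩
    obtain ⟨b, hb⟩ : ∃ b : ℝ≥0, (b : ℝ) = (z - x) / (y - x) :=
      ⟨⟨_, div_nonneg (sub_nonneg.2 hz1) hd.le⟩, rfl⟩
    have hab : a + b = 1 := by
      ext
      push_cast
      rw [ha, hb]
      field_simp; ring
    have hz' : a * x + b * y = z := by
      ext
      push_cast
      rw [ha, hb]
      field_simp; ring
    have hfx : Φ x 1 ≠ ⊤ := (hx.trans_lt (lt_top_iff_ne_top.2 hc)).ne
    have hfy : Φ y 1 ≠ ⊤ := (hy.trans_lt (lt_top_iff_ne_top.2 hc)).ne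
    have key := hΦ.map_conic_le a b hfx hfy
    rw [hz', mul_one, mul_one, hab] at key
    have hcb : c ≠ ⊥ := by rintro rfl; exact hΦ.ne_bot _ _ (le_bot_iff.1 hx)
    lift c to ℝ using ⟨hc, hcb⟩
    rw [← hΦ.coe_toReal hfx, EReal.coe_le_coe_iff] at hx
    rw [← hΦ.coe_toReal hfy, EReal.coe_le_coe_iff] at hy
    refine key.trans (EReal.coe_le_coe_iff.2 ?_)
    have hab' : (a + b : ℝ) = 1 := by exact_mod_cast hab
    calc _ ≤ a * c + b * c := by gcongr
      _ = c := by rw [← add_mul, hab', one_mul]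
  have h2 : (fun p : ℝ≥0 × ℝ≥0 => Φ p.1 p.2) = fun p =>
      if p.2 = 0 then ((p.1 : ℝ) : EReal) * Φ 1 0 else ((p.2 : ℝ) : EReal) * Φ (p.1 / p.2) 1 := by
    funext p
    split_ifs with h
    · rw [← hΦ.homogeneous, h]; simp
    · rw [← hΦ.homogeneous, mul_div_cancel₀ _ h, mul_one]
  rw [h2]
  refine Measurable.ite (measurable_snd (measurableSet_singleton 0)) ?_ ?_
  · fun_prop
  · exact (measurable_snd.coe_nnreal_real.coe_real_ereal).mul
      (h1.comp (measurable_fst.div measurable_snd))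

end IsEntropyFunction
end Sinkhorn

/-! ### Jensen's inequality and contraction of the entropy under a minorized transition. -/

namespace Sinkhorn

/-- The function `Φ (u, v) + A (u + v)`, with negative values replaced by zero. -/
noncomputable def shiftedEntropy (Φ : ℝ≥0 → ℝ≥0 → EReal) (A : ℝ≥0) (u v : ℝ≥0) : ℝ≥0∞ :=
  (Φ u v + ((A * (u + v) : ℝ) : EReal)).toENNReal

namespace IsEntropyFunction

variable {Φ : ℝ≥0 → ℝ≥0 → EReal} {A : ℝ≥0}

theorem measurable_shiftedEntropy (hΦ : IsEntropyFunction Φ) (A : ℝ≥0) :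
    Measurable fun p : ℝ≥0 × ℝ≥0 => shiftedEntropy Φ A p.1 p.2 := by
  unfold shiftedEntropy
  refine Measurable.ereal_toENNReal (hΦ.measurable_uncurry.add ?_)
  fun_prop

theorem shiftedEntropy_one_one (hΦ : IsEntropyFunction Φ) :
    shiftedEntropy Φ A 1 1 = 2 * A := by
  unfold shiftedEntropy
  rw [hΦ.map_one_one, zero_add, EReal.toENNReal_of_ne_top (EReal.coe_ne_top _), EReal.toReal_coe,
    NNReal.coe_one, one_add_one_eq_two, ENNReal.ofReal_mul A.coe_nonneg, mul_comm]
  simp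

theorem shiftedEntropy_smul (hΦ : IsEntropyFunction Φ) (a u v : ℝ≥0) :
    shiftedEntropy Φ A (a * u) (a * v) = a * shiftedEntropy Φ A u v := by
  unfold shiftedEntropy
  rw [hΦ.homogeneous, ← toENNReal_coe_mul]
  congr 1
  rw [EReal.left_distrib_of_nonneg_of_ne_top (by exact_mod_cast a.2) (EReal.coe_ne_top _),
    ← EReal.coe_mul]
  congr 2
  push_cast
  ring

/-- Adding a linear function and taking the positive part both preserve subadditivity, so `A` may be
arbitrary here. -/
theorem shiftedEntropy_add_le (hΦ : IsEntropyFunction Φ) (u₁ v₁ u₂ v₂ : ℝ≥0) :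
    shiftedEntropy Φ A (u₁ + u₂) (v₁ + v₂) ≤
      shiftedEntropy Φ A u₁ v₁ + shiftedEntropy Φ A u₂ v₂ := by
  unfold shiftedEntropy
  refine le_trans (EReal.toENNReal_le_toENNReal ?_) EReal.toENNReal_add_le
  refine (add_le_add_left (hΦ.map_add_le u₁ v₁ u₂ v₂) _).trans_eq ?_
  rw [add_add_add_comm, ← EReal.coe_add]
  congr 2
  push_cast
  ring

/-- Jensen's inequality for entropy functions. -/
theorem shiftedEntropy_lintegral_le (hΦ : IsEntropyFunction Φ) {S : Type*} [MeasurableSpace S]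
    (τ : Measure S) {f g : S → ℝ≥0} (hf : Measurable f) (hg : Measurable g) {F G : ℝ≥0}
    (hF : ∫⁻ x, f x ∂τ = F) (hG : ∫⁻ x, g x ∂τ = G) :
    shiftedEntropy Φ A F G ≤ ∫⁻ x, shiftedEntropy Φ A (f x) (g x) ∂τ := by
  have hfi : Integrable (fun x => (f x : ℝ)) τ :=
    ⟨by fun_prop, by simp [HasFiniteIntegral, hF]⟩
  have hgi : Integrable (fun x => (g x : ℝ)) τ :=
    ⟨by fun_prop, by simp [HasFiniteIntegral, hG]⟩
  have hFi : ∫ x, (f x : ℝ) ∂τ = F := by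
    rw [integral_eq_lintegral_of_nonneg_ae (ae_of_all _ fun x => (f x).coe_nonneg) (by fun_prop)]
    simp [hF]
  have hGi : ∫ x, (g x : ℝ) ∂τ = G := by
    rw [integral_eq_lintegral_of_nonneg_ae (ae_of_all _ fun x => (g x).coe_nonneg) (by fun_prop)]
    simp [hG]
  -- the degenerate case, where `(f, g)` is proportional to `(F, G)`
  have degen : (fun x => (f x : ℝ≥0∞) * G) =ᵐ[τ] (fun x => (g x : ℝ≥0∞) * F) →
      shiftedEntropy Φ A F G ≤ ∫⁻ x, shiftedEntropy Φ A (f x) (g x) ∂τ := by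
    intro h
    by_cases h0 : F + G = 0
    · obtain ⟨rfl, rfl⟩ : F = 0 ∧ G = 0 := by simpa using h0
      simp [shiftedEntropy, hΦ.map_zero_zero]
    · have e : (fun x => shiftedEntropy Φ A (f x) (g x)) =ᵐ[τ]
          fun x => (((f x + g x) / (F + G) : ℝ≥0) : ℝ≥0∞) * shiftedEntropy Φ A F G := by
        filter_upwards [h] with x hx
        have hx' : f x * G = g x * F := by exact_mod_cast hx
        rw [← hΦ.shiftedEntropy_smul]
        congr 1
        · rw [div_mul_eq_mul_div, eq_div_iff h0, mul_add, add_mul, hx']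
        · rw [div_mul_eq_mul_div, eq_div_iff h0, mul_add, add_mul, hx', add_comm]
      rw [lintegral_congr_ae e, lintegral_mul_const _ (by fun_prop)]
      have : ∫⁻ x, (((f x + g x) / (F + G) : ℝ≥0) : ℝ≥0∞) ∂τ = 1 := by
        simp_rw [ENNReal.coe_div h0, ENNReal.coe_add, ENNReal.div_eq_inv_mul]
        rw [lintegral_const_mul _ (by fun_prop), lintegral_add_left (by fun_prop), hF, hG,
          ENNReal.inv_mul_cancel (by exact_mod_cast h0) (by simp)]
      rw [this, one_mul]
  by_cases h₁ : ∃ u v, v * F < u * G ∧ Φ u v ≠ ⊤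
  · by_cases h₂ : ∃ u v, u * G < v * F ∧ Φ u v ≠ ⊤
    -- The minorant has no constant term, so its integral depends only on `F` and `G`; the total
    -- mass of `τ` plays no role.
    · obtain ⟨α, β, hl, he⟩ := hΦ.exists_linear_minorant h₁ h₂
      have hint : Integrable (fun x => (α + A) * (f x : ℝ) + (β + A) * (g x : ℝ)) τ :=
        (hfi.const_mul _).add (hgi.const_mul _)
      calc shiftedEntropy Φ A F G
          = ENNReal.ofReal (∫ x, ((α + A) * (f x : ℝ) + (β + A) * (g x : ℝ)) ∂τ) := by
            rw [integral_add (hfi.const_mul _) (hgi.const_mul _), integral_const_mul,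
              integral_const_mul, hFi, hGi]
            unfold shiftedEntropy
            rw [he, ← EReal.coe_add, EReal.toENNReal_of_ne_top (EReal.coe_ne_top _),
              EReal.toReal_coe]
            congr 1
            ring
        _ ≤ ∫⁻ x, ENNReal.ofReal ((α + A) * (f x : ℝ) + (β + A) * (g x : ℝ)) ∂τ := by
            rw [integral_eq_lintegral_pos_part_sub_lintegral_neg_part hint]
            exact (ENNReal.ofReal_le_ofReal (sub_le_self _ ENNReal.toReal_nonneg)).trans
              ENNReal.ofReal_toReal_le
        _ ≤ _ := by
            refine lintegral_mono fun x => ?_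
            unfold shiftedEntropy
            have := EReal.toENNReal_le_toENNReal
              (add_le_add_left (hl (f x) (g x)) ((A * (f x + g x) : ℝ) : EReal))
            rw [← EReal.coe_add, EReal.toENNReal_of_ne_top (EReal.coe_ne_top _),
              EReal.toReal_coe] at this
            refine le_trans (le_of_eq ?_) this
            congr 1
            ring
    · push Not at h₂
      by_cases htop : ∫⁻ x, shiftedEntropy Φ A (f x) (g x) ∂τ = ∞
      · rw [htop]; exact le_top
      have hms : Measurable fun x => shiftedEntropy Φ A (f x) (g x) :=
        (hΦ.measurable_shiftedEntropy A).comp (hf.prodMk hg)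
      -- `Φ` is infinite strictly on one side of the ray, so a finite integral keeps `(f, g)` on the
      -- other side almost everywhere. Both sides of this inequality integrate to `F * G`, so
      -- equality holds and the degenerate case applies.
      have hle : (fun x => (g x : ℝ≥0∞) * F) ≤ᵐ[τ] fun x => (f x : ℝ≥0∞) * G := by
        filter_upwards [ae_lt_top hms htop] with x hx
        by_contra hlt
        push Not at hlt
        have := h₂ (f x) (g x) (by exact_mod_cast hlt)
        rw [shiftedEntropy, this, EReal.top_add_coe] at hx
        simp at hx
      refine degen (ae_eq_of_ae_le_of_lintegral_le hle ?_ (by fun_prop) ?_).symm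
      · rw [lintegral_mul_const _ (by fun_prop), hG]
        exact ENNReal.mul_ne_top ENNReal.coe_ne_top ENNReal.coe_ne_top
      · rw [lintegral_mul_const _ (by fun_prop), lintegral_mul_const _ (by fun_prop), hG, hF,
          mul_comm]
  · push Not at h₁
    by_cases htop : ∫⁻ x, shiftedEntropy Φ A (f x) (g x) ∂τ = ∞
    · rw [htop]; exact le_top
    have hms : Measurable fun x => shiftedEntropy Φ A (f x) (g x) :=
      (hΦ.measurable_shiftedEntropy A).comp (hf.prodMk hg)
    have hle : (fun x => (f x : ℝ≥0∞) * G) ≤ᵐ[τ] fun x => (g x : ℝ≥0∞) * F := by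
      filter_upwards [ae_lt_top hms htop] with x hx
      by_contra hlt
      push Not at hlt
      have := h₁ (f x) (g x) (by exact_mod_cast hlt)
      rw [shiftedEntropy, this, EReal.top_add_coe] at hx
      simp at hx
    refine degen (ae_eq_of_ae_le_of_lintegral_le hle ?_ (by fun_prop) ?_)
    · rw [lintegral_mul_const _ (by fun_prop), hF]
      exact ENNReal.mul_ne_top ENNReal.coe_ne_top ENNReal.coe_ne_top
    · rw [lintegral_mul_const _ (by fun_prop), lintegral_mul_const _ (by fun_prop), hG, hF,
        mul_comm]

/-- A transition with density bounded below by `ε` contracts the entropy by `1 - ε`. -/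
theorem lintegral_shiftedEntropy_le (hΦ : IsEntropyFunction Φ) {X Y : Type*} [MeasurableSpace X]
    [MeasurableSpace Y] (μ : Measure X) [IsProbabilityMeasure μ] (η : Measure Y)
    [IsProbabilityMeasure η] {s : X → Y → ℝ≥0} (hs : Measurable (Function.uncurry s))
    {ε : ℝ≥0} (hε : ∀ x y, ε ≤ s x y) (hs1 : ∀ y, ∫⁻ x, s x y ∂μ = 1)
    {f g : Y → ℝ≥0} (hf : Measurable f) (hg : Measurable g)
    (hf1 : ∫⁻ y, f y ∂η = 1) (hg1 : ∫⁻ y, g y ∂η = 1)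
    {F G : X → ℝ≥0} (hF : ∀ x, ∫⁻ y, s x y * f y ∂η = F x)
    (hG : ∀ x, ∫⁻ y, s x y * g y ∂η = G x) :
    ∫⁻ x, shiftedEntropy Φ A (F x) (G x) ∂μ ≤
      (1 - ε : ℝ≥0) * ∫⁻ y, shiftedEntropy Φ A (f y) (g y) ∂η + ε * shiftedEntropy Φ A 1 1 := by
  have hs' : Measurable (Function.uncurry fun x y => s x y - ε) := hs.sub_const ε
  have hsx : ∀ x, Measurable (s x) := fun x => hs.comp measurable_prodMk_left
  have hsy : ∀ y, Measurable fun x => s x y := fun y => hs.comp measurable_prodMk_right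
  -- Decompose `s = ε + (s - ε)`. As `h` has mass one, the constant part contributes exactly `ε`,
  -- the same for both densities.
  have split : ∀ {h : Y → ℝ≥0}, Measurable h → ∫⁻ y, h y ∂η = 1 → ∀ {H : X → ℝ≥0},
      (∀ x, ∫⁻ y, s x y * h y ∂η = H x) → ∀ x, ∃ H' : ℝ≥0,
        H x = ε + H' ∧ ∫⁻ y, ((s x y - ε) * h y : ℝ≥0) ∂η = H' := by
    intro h hh h1 H hH x
    have e : (H x : ℝ≥0∞) = ε + ∫⁻ y, ((s x y - ε) * h y : ℝ≥0) ∂η := by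
      rw [← hH, ← mul_one (ε : ℝ≥0∞), ← h1, ← lintegral_const_mul _ (by fun_prop),
        ← lintegral_add_left (by fun_prop)]
      refine lintegral_congr fun y => ?_
      rw [← ENNReal.coe_mul, ← ENNReal.coe_mul, ← ENNReal.coe_add, ← add_mul,
        add_tsub_cancel_of_le (hε x y)]
    have hne : ∫⁻ y, ((s x y - ε) * h y : ℝ≥0) ∂η ≠ ∞ := fun htop => by rw [htop, add_top] at e; exact ENNReal.coe_ne_top e
    lift ∫⁻ y, ((s x y - ε) * h y : ℝ≥0) ∂η to ℝ≥0 using hne with H' hH'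
    exact ⟨H', by exact_mod_cast e, rfl⟩
  have hms : Measurable fun y => shiftedEntropy Φ A (f y) (g y) :=
    (hΦ.measurable_shiftedEntropy A).comp (hf.prodMk hg)
  -- Subadditivity separates the common part `(ε, ε)` from the remainder, to which Jensen applies.
  -- Integrating over `x` then produces the factor `1 - ε`, the remaining mass of each column.
  have pointwise : ∀ x, shiftedEntropy Φ A (F x) (G x) ≤ ε * shiftedEntropy Φ A 1 1 +
      ∫⁻ y, (s x y - ε : ℝ≥0) * shiftedEntropy Φ A (f y) (g y) ∂η := by
    intro x
    obtain ⟨F', hF1, hF2⟩ := split hf hf1 hF x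
    obtain ⟨G', hG1, hG2⟩ := split hg hg1 hG x
    rw [hF1, hG1]
    refine (hΦ.shiftedEntropy_add_le _ _ _ _).trans (add_le_add (le_of_eq ?_) ?_)
    · rw [← hΦ.shiftedEntropy_smul, mul_one]
    · refine (hΦ.shiftedEntropy_lintegral_le η (((hsx x).sub_const ε).mul hf)
        (((hsx x).sub_const ε).mul hg) hF2 hG2).trans_eq ?_
      exact lintegral_congr fun y => hΦ.shiftedEntropy_smul _ _ _
  have hmass : ∀ y, ∫⁻ x, (s x y - ε : ℝ≥0) ∂μ = (1 - ε : ℝ≥0) := by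
    intro y
    simp_rw [ENNReal.coe_sub]
    rw [lintegral_sub measurable_const (by simp) (ae_of_all _ fun x => ENNReal.coe_le_coe.2 (hε x y)),
      hs1]
    simp
  calc ∫⁻ x, shiftedEntropy Φ A (F x) (G x) ∂μ
      ≤ ∫⁻ x, (ε * shiftedEntropy Φ A 1 1 +
          ∫⁻ y, (s x y - ε : ℝ≥0) * shiftedEntropy Φ A (f y) (g y) ∂η) ∂μ :=
        lintegral_mono pointwise
    _ = ε * shiftedEntropy Φ A 1 1 +
          ∫⁻ x, ∫⁻ y, (s x y - ε : ℝ≥0) * shiftedEntropy Φ A (f y) (g y) ∂η ∂μ := by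
        rw [lintegral_add_left measurable_const]; simp
    _ = ε * shiftedEntropy Φ A 1 1 +
          ∫⁻ y, ∫⁻ x, (s x y - ε : ℝ≥0) * shiftedEntropy Φ A (f y) (g y) ∂μ ∂η := by
        rw [lintegral_lintegral_swap]
        exact (hs'.coe_nnreal_ennreal.mul (hms.comp measurable_snd)).aemeasurable
    _ = _ := by
        rw [add_comm]
        congr 1
        rw [← lintegral_const_mul _ hms]
        refine lintegral_congr fun y => ?_
        rw [lintegral_mul_const _ ((hsy y).sub_const ε).coe_nnreal_ennreal, hmass]

/-- The entropy of two probability measures given by their densities. -/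
theorem phiEntropy_withDensity (hΦ : IsEntropyFunction Φ)
    (hA : ∀ u v : ℝ≥0, ((-(A * (u + v)) : ℝ) : EReal) ≤ Φ u v)
    {S : Type*} [MeasurableSpace S] (γ : Measure S) [SigmaFinite γ] {f g : S → ℝ≥0}
    (hf : Measurable f) (hg : Measurable g) (hf1 : ∫⁻ y, f y ∂γ = 1) (hg1 : ∫⁻ y, g y ∂γ = 1) :
    phiEntropy Φ (γ.withDensity fun x => f x) (γ.withDensity fun x => g x) =
      ((∫⁻ x, shiftedEntropy Φ A (f x) (g x) ∂γ : ℝ≥0∞) : EReal) -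
        ((shiftedEntropy Φ A 1 1 : ℝ≥0∞) : EReal) := by
  have : IsProbabilityMeasure (γ.withDensity fun x => f x) :=
    ⟨by rw [withDensity_apply _ MeasurableSet.univ, Measure.restrict_univ, hf1]⟩
  have : IsProbabilityMeasure (γ.withDensity fun x => g x) :=
    ⟨by rw [withDensity_apply _ MeasurableSet.univ, Measure.restrict_univ, hg1]⟩
  rw [phiEntropy_eq_phiEntropyWrt hΦ γ _ _ (withDensity_absolutelyContinuous _ _)
    (withDensity_absolutelyContinuous _ _)]
  unfold phiEntropyWrt
  have hfg : (fun x => Φ ((γ.withDensity fun x => (f x : ℝ≥0∞)).rnDeriv γ x).toNNReal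
      ((γ.withDensity fun x => (g x : ℝ≥0∞)).rnDeriv γ x).toNNReal) =ᵐ[γ]
      fun x => Φ (f x) (g x) := by
    filter_upwards [Measure.rnDeriv_withDensity γ hf.coe_nnreal_ennreal,
      Measure.rnDeriv_withDensity γ hg.coe_nnreal_ennreal] with x h1 h2
    rw [h1, h2, ENNReal.toNNReal_coe, ENNReal.toNNReal_coe]
  unfold erealIntegral
  rw [lintegral_congr_ae (hfg.mono fun x hx => congrArg EReal.toENNReal hx),
    lintegral_congr_ae (hfg.mono fun x hx => congrArg (fun z => (-z).toENNReal) hx)]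
  -- The identity `Φ + A(f + g) = Φ⁺ - Φ⁻ + A(f + g)` rearranged without subtraction; by `hA` the
  -- truncation in `shiftedEntropy` is inactive.
  have hpt : ∀ x, shiftedEntropy Φ A (f x) (g x) + (-Φ (f x) (g x)).toENNReal =
      (Φ (f x) (g x)).toENNReal + A * (f x + g x) := by
    intro x
    by_cases htop : Φ (f x) (g x) = ⊤
    · rw [shiftedEntropy, htop, EReal.top_add_coe]
      simp
    have hAx := hA (f x) (g x)
    unfold shiftedEntropy
    rw [← hΦ.coe_toReal htop] at hAx ⊢
    rw [EReal.coe_le_coe_iff] at hAx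
    rw [← EReal.coe_add, ← EReal.coe_neg, EReal.toENNReal_of_ne_top (EReal.coe_ne_top _),
      EReal.toENNReal_of_ne_top (EReal.coe_ne_top _),
      EReal.toENNReal_of_ne_top (EReal.coe_ne_top _)]
    simp only [EReal.toReal_coe]
    have e : (A : ℝ≥0∞) * (f x + g x) = ENNReal.ofReal (A * (f x + g x)) := by
      rw [ENNReal.ofReal_mul A.coe_nonneg, ENNReal.ofReal_add (f x).coe_nonneg (g x).coe_nonneg]
      simp
    rw [e]
    rcases le_total 0 (Φ (f x) (g x)).toReal with h | h
    · rw [ENNReal.ofReal_of_nonpos (neg_nonpos.2 h), add_zero,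
        ENNReal.ofReal_add h (by positivity)]
    · rw [ENNReal.ofReal_of_nonpos h, zero_add,
        ← ENNReal.ofReal_add (by linarith) (neg_nonneg.2 h)]
      congr 1
      ring
  have hms : Measurable fun y => shiftedEntropy Φ A (f y) (g y) :=
    (hΦ.measurable_shiftedEntropy A).comp (hf.prodMk hg)
  have hI : ∫⁻ x, shiftedEntropy Φ A (f x) (g x) ∂γ + ∫⁻ x, (-Φ (f x) (g x)).toENNReal ∂γ =
      ∫⁻ x, (Φ (f x) (g x)).toENNReal ∂γ + 2 * A := by
    rw [← lintegral_add_left hms, lintegral_congr hpt, lintegral_add_right _ (by fun_prop),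
      lintegral_const_mul _ (by fun_prop), lintegral_add_left (by fun_prop), hf1, hg1,
      one_add_one_eq_two, mul_comm (A : ℝ≥0∞)]
  -- Integrability of the negative part excludes `∞ - ∞` in the entropy.
  have hneg : ∫⁻ x, (-Φ (f x) (g x)).toENNReal ∂γ ≠ ∞ := by
    have hle : ∫⁻ x, (-Φ (f x) (g x)).toENNReal ∂γ ≤ ∫⁻ x, A * (f x + g x) ∂γ := by
      refine lintegral_mono fun x => ?_
      have h1 : -Φ (f x) (g x) ≤ ((A * (f x + g x) : ℝ) : EReal) := by
        rw [EReal.neg_le, ← EReal.coe_neg]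
        exact hA _ _
      refine (EReal.toENNReal_le_toENNReal h1).trans_eq ?_
      rw [EReal.toENNReal_of_ne_top (EReal.coe_ne_top _), EReal.toReal_coe,
        ENNReal.ofReal_mul A.coe_nonneg, ENNReal.ofReal_add (f x).coe_nonneg (g x).coe_nonneg]
      simp
    refine (hle.trans_lt ?_).ne
    rw [lintegral_const_mul _ (by fun_prop), lintegral_add_left (by fun_prop), hf1, hg1]
    exact ENNReal.mul_lt_top ENNReal.coe_lt_top (by simp)
  rw [hΦ.shiftedEntropy_one_one]
  generalize ∫⁻ x, shiftedEntropy Φ A (f x) (g x) ∂γ = I at *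
  generalize ∫⁻ x, (-Φ (f x) (g x)).toENNReal ∂γ = N at *
  generalize ∫⁻ x, (Φ (f x) (g x)).toENNReal ∂γ = P at *
  lift N to ℝ≥0 using hneg
  by_cases hP : P = ∞
  · have hI' : I = ∞ := by
      rw [hP] at hI
      by_contra hne
      lift I to ℝ≥0 using hne
      simp [← ENNReal.coe_add] at hI
    rw [hP, hI']
    rw [show (2 : ℝ≥0∞) * A = ((2 * A : ℝ≥0) : ℝ≥0∞) by push_cast; rfl]
    simp only [EReal.coe_ennreal_top]
    rw [show ((N : ℝ≥0∞) : EReal) = ((N : ℝ) : EReal) from rfl,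
      show (((2 * A : ℝ≥0) : ℝ≥0∞) : EReal) = (((2 * A : ℝ≥0) : ℝ) : EReal) from rfl]
    rw [EReal.top_sub_coe, EReal.top_sub_coe]
  · lift P to ℝ≥0 using hP
    have hIne : I ≠ ∞ := by
      rintro rfl
      rw [top_add, show (2 : ℝ≥0∞) * A = ((2 * A : ℝ≥0) : ℝ≥0∞) by push_cast; rfl,
        ← ENNReal.coe_add] at hI
      exact ENNReal.top_ne_coe hI
    lift I to ℝ≥0 using hIne
    have h : (I : ℝ) + N = P + 2 * A := by exact_mod_cast hI
    rw [show (2 : ℝ≥0∞) * A = ((2 * A : ℝ≥0) : ℝ≥0∞) by push_cast; rfl]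
    rw [show ((N : ℝ≥0∞) : EReal) = ((N : ℝ) : EReal) from rfl,
      show ((P : ℝ≥0∞) : EReal) = ((P : ℝ) : EReal) from rfl,
      show ((I : ℝ≥0∞) : EReal) = ((I : ℝ) : EReal) from rfl,
      show (((2 * A : ℝ≥0) : ℝ≥0∞) : EReal) = (((2 * A : ℝ≥0) : ℝ) : EReal) from rfl,
      ← EReal.coe_sub, ← EReal.coe_sub]
    congr 1
    push_cast
    linarith

/-- A transition with density bounded below by `ε` contracts the `Φ`-entropy by `1 - ε`. -/
theorem phiEntropy_contraction (hΦ : IsEntropyFunction Φ) {X Y : Type*} [MeasurableSpace X]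
    [MeasurableSpace Y] (μ : Measure X) [IsProbabilityMeasure μ] (η : Measure Y)
    [IsProbabilityMeasure η] {s : X → Y → ℝ≥0} (hs : Measurable (Function.uncurry s))
    {ε : ℝ≥0} (hε1 : ε < 1) (hε : ∀ x y, ε ≤ s x y) (hs1 : ∀ y, ∫⁻ x, s x y ∂μ = 1)
    {f g : Y → ℝ≥0} (hf : Measurable f) (hg : Measurable g)
    (hf1 : ∫⁻ y, f y ∂η = 1) (hg1 : ∫⁻ y, g y ∂η = 1)
    {F G : X → ℝ≥0} (hF : ∀ x, ∫⁻ y, s x y * f y ∂η = F x)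
    (hG : ∀ x, ∫⁻ y, s x y * g y ∂η = G x) :
    phiEntropy Φ (μ.withDensity fun x => F x) (μ.withDensity fun x => G x) ≤
      ((1 - ε : ℝ) : EReal) *
        phiEntropy Φ (η.withDensity fun y => f y) (η.withDensity fun y => g y) := by
  obtain ⟨A, hA⟩ := hΦ.exists_lower_bound
  have meas : ∀ {h : Y → ℝ≥0} {H : X → ℝ≥0}, Measurable h → (∀ x, ∫⁻ y, s x y * h y ∂η = H x) →
      Measurable H := by
    intro h H hh hH
    have h1 : Measurable fun x => ∫⁻ y, s x y * h y ∂η :=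
      Measurable.lintegral_prod_right'
        (f := fun p : X × Y => (s p.1 p.2 : ℝ≥0∞) * (h p.2 : ℝ≥0∞))
        (hs.coe_nnreal_ennreal.mul (hh.comp measurable_snd).coe_nnreal_ennreal)
    simp_rw [hH] at h1
    simpa using h1.ennreal_toNNReal
  have mass : ∀ {h : Y → ℝ≥0} {H : X → ℝ≥0}, Measurable h → ∫⁻ y, h y ∂η = 1 →
      (∀ x, ∫⁻ y, s x y * h y ∂η = H x) → ∫⁻ x, H x ∂μ = 1 := by
    intro h H hh h1 hH
    simp_rw [← hH]
    rw [lintegral_lintegral_swap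
      (hs.coe_nnreal_ennreal.mul (hh.comp measurable_snd).coe_nnreal_ennreal).aemeasurable, ← h1]
    refine lintegral_congr fun y => ?_
    have hsy : Measurable fun x => s x y := hs.comp measurable_prodMk_right
    rw [lintegral_mul_const _ hsy.coe_nnreal_ennreal, hs1, one_mul]
  rw [hΦ.phiEntropy_withDensity hA μ (meas hf hF) (meas hg hG) (mass hf hf1 hF) (mass hg hg1 hG),
    hΦ.phiEntropy_withDensity hA η hf hg hf1 hg1]
  -- With `B = 2A` the contribution of the shift, `J ≤ (1 - ε) I + ε B` is the same as `J - B ≤ (1 -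
  -- ε) (I - B)`, so the shift cancels.
  have key := hΦ.lintegral_shiftedEntropy_le (A := A) μ η hs hε hs1 hf hg hf1 hg1 hF hG
  rw [hΦ.shiftedEntropy_one_one] at key ⊢
  generalize ∫⁻ x, shiftedEntropy Φ A (F x) (G x) ∂μ = J at *
  generalize ∫⁻ y, shiftedEntropy Φ A (f y) (g y) ∂η = I at *
  rw [show (2 : ℝ≥0∞) * A = ((2 * A : ℝ≥0) : ℝ≥0∞) by push_cast; rfl] at *
  generalize 2 * A = B at *
  have hδ : (0 : ℝ) < 1 - ε := sub_pos.2 (by exact_mod_cast hε1)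
  have cast : ∀ a : ℝ≥0, ((a : ℝ≥0∞) : EReal) = ((a : ℝ) : EReal) := fun a => rfl
  -- For infinite entropy the strict inequality `ε < 1` matters: it keeps the right side at `⊤`,
  -- since `0 * ⊤ = 0`.
  by_cases hI : I = ∞
  · rw [hI, cast B, EReal.coe_ennreal_top, EReal.top_sub_coe, EReal.coe_mul_top_of_pos hδ]
    exact le_top
  lift I to ℝ≥0 using hI
  have hJ : J ≠ ∞ := (key.trans_lt (by norm_cast; exact ENNReal.coe_lt_top)).ne
  lift J to ℝ≥0 using hJ
  have h : J ≤ (1 - ε) * I + ε * B := by exact_mod_cast key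
  have h' : (J : ℝ) ≤ (1 - ε) * I + ε * B := by
    have := NNReal.coe_le_coe.2 h
    push_cast [NNReal.coe_sub hε1.le] at this
    exact this
  rw [cast, cast, cast, ← EReal.coe_sub, ← EReal.coe_sub, ← EReal.coe_mul, EReal.coe_le_coe_iff]
  nlinarith

end IsEntropyFunction
end Sinkhorn

/-! ### Normalizers of potentials and the contraction of their relative spread. -/

namespace Sinkhorn

variable {X Y : Type*} [MeasurableSpace X] [MeasurableSpace Y]

/-- A measurable positive cost function `w = e^{-W}` whose values along rows and columns differ at
most by the factor `κ`. -/
structure IsComparable (w : X → Y → ℝ≥0∞) (κ : ℝ≥0) : Prop where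
  measurable : Measurable (Function.uncurry w)
  ne_zero : ∀ x y, w x y ≠ 0
  ne_top : ∀ x y, w x y ≠ ∞
  le_left : ∀ x x' y, w x y ≤ κ * w x' y
  le_right : ∀ x y y', w x y ≤ κ * w x y'
  one_lt : 1 < κ

/-- A measurable, positive, finite and integrable function. -/
structure IsPotential (μ : Measure X) (f : X → ℝ≥0∞) : Prop where
  measurable : Measurable f
  ne_zero : ∀ x, f x ≠ 0
  ne_top : ∀ x, f x ≠ ∞
  lintegral_ne_top : ∫⁻ x, f x ∂μ ≠ ∞

/-- The normalisation `y ↦ 1 / ∫ w(x, y) f(x) μ(dx)`. -/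
noncomputable def normalizer (μ : Measure X) (w : X → Y → ℝ≥0∞) (f : X → ℝ≥0∞) (y : Y) : ℝ≥0∞ :=
  (∫⁻ x, w x y * f x ∂μ)⁻¹

namespace IsComparable

variable {w : X → Y → ℝ≥0∞} {κ : ℝ≥0}

theorem swap (hw : IsComparable w κ) : IsComparable (fun y x => w x y) κ where
  measurable := hw.measurable.comp measurable_swap
  ne_zero y x := hw.ne_zero x y
  ne_top y x := hw.ne_top x y
  le_left y y' x := hw.le_right x y y'
  le_right y x x' := hw.le_left x x' y
  one_lt := hw.one_lt

theorem measurable_left (hw : IsComparable w κ) (y : Y) : Measurable fun x => w x y :=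
  hw.measurable.comp measurable_prodMk_right

variable {μ : Measure X} [IsProbabilityMeasure μ] {η : Measure Y} [IsProbabilityMeasure η]
  {f f' : X → ℝ≥0∞}

theorem lintegral_mul_ne_top (hw : IsComparable w κ) (hf : IsPotential μ f) (y : Y) :
    ∫⁻ x, w x y * f x ∂μ ≠ ∞ := by
  obtain ⟨x₀⟩ : Nonempty X := nonempty_of_isProbabilityMeasure μ
  have : ∫⁻ x, w x y * f x ∂μ ≤ ∫⁻ x, κ * w x₀ y * f x ∂μ :=
    lintegral_mono fun x => mul_le_mul_left (hw.le_left x x₀ y) _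
  refine (this.trans_lt ?_).ne
  rw [lintegral_const_mul _ hf.measurable]
  exact ENNReal.mul_lt_top (ENNReal.mul_lt_top ENNReal.coe_lt_top (hw.ne_top x₀ y).lt_top)
    hf.lintegral_ne_top.lt_top

theorem lintegral_mul_ne_zero (hw : IsComparable w κ) (hf : IsPotential μ f) (y : Y) :
    ∫⁻ x, w x y * f x ∂μ ≠ 0 := by
  rw [Ne, lintegral_eq_zero_iff (f := fun x => w x y * f x) ((hw.measurable_left y).mul hf.measurable)]
  intro h
  obtain ⟨x, hx⟩ := h.exists
  exact mul_ne_zero (hw.ne_zero x y) (hf.ne_zero x) hx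

theorem normalizer_ne_zero (hw : IsComparable w κ) (hf : IsPotential μ f) (y : Y) :
    normalizer μ w f y ≠ 0 :=
  ENNReal.inv_ne_zero.2 (hw.lintegral_mul_ne_top hf y)

theorem normalizer_ne_top (hw : IsComparable w κ) (hf : IsPotential μ f) (y : Y) :
    normalizer μ w f y ≠ ∞ :=
  ENNReal.inv_ne_top.2 (hw.lintegral_mul_ne_zero hf y)

theorem coe_ne_zero (hw : IsComparable w κ) : (κ : ℝ≥0∞) ≠ 0 :=
  ENNReal.coe_ne_zero.2 (zero_lt_one.trans hw.one_lt).ne'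

/-- Comparability of `w` survives integration and inversion, for every `f`. One half step thus
produces a potential of spread at most `κ` even from an unbounded `V`. -/
theorem normalizer_le (hw : IsComparable w κ) (μ : Measure X) (f : X → ℝ≥0∞) (y y' : Y) :
    normalizer μ w f y ≤ κ * normalizer μ w f y' := by
  unfold normalizer
  have h : ∫⁻ x, w x y' * f x ∂μ ≤ κ * ∫⁻ x, w x y * f x ∂μ := by
    rw [← lintegral_const_mul' _ _ ENNReal.coe_ne_top]
    refine lintegral_mono fun x => ?_
    rw [← mul_assoc]
    exact mul_le_mul_left (hw.le_right x y' y) _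
  have h' := ENNReal.inv_le_inv.2 h
  rw [ENNReal.mul_inv (Or.inl hw.coe_ne_zero) (Or.inl ENNReal.coe_ne_top)] at h'
  refine le_trans (le_of_eq ?_) (mul_le_mul_right h' (κ : ℝ≥0∞))
  rw [← mul_assoc, ENNReal.mul_inv_cancel hw.coe_ne_zero ENNReal.coe_ne_top, one_mul]

theorem measurable_normalizer (hw : IsComparable w κ) (hf : Measurable f) :
    Measurable (normalizer μ w f) :=
  Measurable.inv (Measurable.lintegral_prod_left' (f := fun p : X × Y => w p.1 p.2 * f p.1)
    (hw.measurable.mul (hf.comp measurable_fst)))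

theorem isPotential_normalizer (hw : IsComparable w κ) (hf : IsPotential μ f)
    (η : Measure Y) [IsProbabilityMeasure η] : IsPotential η (normalizer μ w f) where
  measurable := hw.measurable_normalizer hf.measurable
  ne_zero := hw.normalizer_ne_zero hf
  ne_top := hw.normalizer_ne_top hf
  lintegral_ne_top := by
    obtain ⟨y₀⟩ : Nonempty Y := nonempty_of_isProbabilityMeasure η
    have : ∫⁻ y, normalizer μ w f y ∂η ≤ ∫⁻ _, κ * normalizer μ w f y₀ ∂η :=
      lintegral_mono fun y => hw.normalizer_le μ f y y₀
    refine (this.trans_lt ?_).ne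
    rw [lintegral_const, measure_univ, mul_one]
    exact ENNReal.mul_lt_top ENNReal.coe_lt_top (hw.normalizer_ne_top hf y₀).lt_top

theorem normalizer_mul_lintegral (hw : IsComparable w κ) (hf : IsPotential μ f) (y : Y) :
    normalizer μ w f y * ∫⁻ x, w x y * f x ∂μ = 1 :=
  ENNReal.inv_mul_cancel (hw.lintegral_mul_ne_zero hf y) (hw.lintegral_mul_ne_top hf y)

theorem lintegral_normalizer_mul (hw : IsComparable w κ) (hf : IsPotential μ f) (y : Y) :
    ∫⁻ x, normalizer μ w f y * w x y * f x ∂μ = 1 := by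
  rw [← hw.normalizer_mul_lintegral hf y,
    ← lintegral_const_mul (f := fun x => w x y * f x) _
      ((hw.measurable_left y).mul hf.measurable)]
  simp_rw [mul_assoc]

/-- The normalised transition has a density bounded below. -/
theorem le_normalizer_mul (hw : IsComparable w κ) (hf : IsPotential μ f)
    (hκ : ∀ x x', f x ≤ κ * f x') (x : X) (y : Y) :
    ((κ ^ 2)⁻¹ : ℝ≥0) ≤ normalizer μ w f y * w x y * f x := by
  -- The density has mean one in `x`; moving from `x'` to `x` costs one factor `κ` for `w` and one
  -- for `f`.
  have h : (1 : ℝ≥0∞) ≤ ((κ ^ 2 : ℝ≥0) : ℝ≥0∞) * (normalizer μ w f y * w x y * f x) := by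
    calc (1 : ℝ≥0∞) = ∫⁻ x', normalizer μ w f y * w x' y * f x' ∂μ :=
          (hw.lintegral_normalizer_mul hf y).symm
      _ ≤ ∫⁻ _, ((κ ^ 2 : ℝ≥0) : ℝ≥0∞) * (normalizer μ w f y * w x y * f x) ∂μ := by
          refine lintegral_mono fun x' => ?_
          calc normalizer μ w f y * w x' y * f x'
              ≤ normalizer μ w f y * (κ * w x y) * (κ * f x) := by
                gcongr
                · exact hw.le_left x' x y
                · exact hκ x' x
            _ = _ := by push_cast; ring
      _ = _ := by rw [lintegral_const, measure_univ, mul_one]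
  rw [ENNReal.coe_inv (pow_pos (zero_lt_one.trans hw.one_lt) 2).ne']
  rw [mul_comm] at h
  rw [← one_div]
  exact ENNReal.div_le_of_le_mul h

/-- Although normalization inverts, the ratio of two normalizers is the average of `f' / f` under a
probability density, so the minorization of that density can be exploited. -/
theorem normalizer_div_normalizer (hw : IsComparable w κ) (hf : IsPotential μ f)
    (f' : X → ℝ≥0∞) (y : Y) :
    normalizer μ w f y / normalizer μ w f' y =
      ∫⁻ x, normalizer μ w f y * w x y * f x * (f' x / f x) ∂μ := by
  have : ∀ x, normalizer μ w f y * w x y * f x * (f' x / f x) =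
      normalizer μ w f y * (w x y * f' x) := by
    intro x
    rw [mul_assoc, mul_assoc, ENNReal.mul_div_cancel (hf.ne_zero x) (hf.ne_top x)]
  simp_rw [this]
  rw [lintegral_const_mul' _ _ (hw.normalizer_ne_top hf y), div_eq_mul_inv]
  congr 1
  unfold normalizer
  rw [inv_inv]

/-- Normalisation contracts the relative spread of a ratio of potentials. -/
theorem normalizer_div_normalizer_le (hw : IsComparable w κ) (hf : IsPotential μ f)
    (hκ : ∀ x x', f x ≤ κ * f x') (hf' : Measurable f') {R : ℝ≥0∞} (hR : R ≠ ∞)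
    (h : ∀ x x', f' x / f x ≤ (1 + R) * (f' x' / f x')) (y y' : Y) :
    normalizer μ w f y / normalizer μ w f' y ≤
      (1 + ((1 - (κ ^ 2)⁻¹ : ℝ≥0) : ℝ≥0∞) * R) *
        (normalizer μ w f y' / normalizer μ w f' y') := by
  set ε : ℝ≥0 := (κ ^ 2)⁻¹ with hε
  set r : X → ℝ≥0∞ := fun x => f' x / f x with hr
  have hrm : Measurable r := hf'.div hf.measurable
  have hε1 : ε ≤ 1 := inv_le_one_of_one_le₀ (one_le_pow₀ hw.one_lt.le)
  -- The hypothesis `h` confines `r` to the range from `a` to `(1 + R) * a`.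
  set a : ℝ≥0∞ := ⨅ x, r x with ha
  have hra : ∀ x, a ≤ r x := fun x => iInf_le _ x
  have hrb : ∀ x, r x ≤ (1 + R) * a := by
    intro x
    rw [ha, ENNReal.mul_iInf_of_ne (by simp) (ENNReal.add_ne_top.2 ⟨ENNReal.one_ne_top, hR⟩)]
    exact le_iInf fun x' => h x x'
  set s : Y → X → ℝ≥0∞ := fun y x => normalizer μ w f y * w x y * f x with hs
  have hsm : ∀ y, Measurable (s y) := fun y =>
    ((hw.measurable_left y).const_mul _).mul hf.measurable
  have hsε : ∀ y x, (ε : ℝ≥0∞) ≤ s y x := fun y x => hw.le_normalizer_mul hf hκ x y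
  have hs1 : ∀ y, ∫⁻ x, s y x ∂μ = 1 := hw.lintegral_normalizer_mul hf
  have hmass : ∀ y, ∫⁻ x, (s y x - ε) ∂μ = (1 - ε : ℝ≥0) := by
    intro y
    rw [lintegral_sub measurable_const (by simp) (ae_of_all _ (hsε y)), hs1]
    simp
  -- The first term does not depend on `y`; only the remainder, of mass `1 - ε`, can tell `y` from
  -- `y'`.
  have hsplit : ∀ y, normalizer μ w f y / normalizer μ w f' y =
      ε * ∫⁻ x, r x ∂μ + ∫⁻ x, (s y x - ε) * r x ∂μ := by
    intro y
    rw [hw.normalizer_div_normalizer hf, ← lintegral_const_mul _ hrm,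
      ← lintegral_add_left (hrm.const_mul _)]
    refine lintegral_congr fun x => ?_
    rw [← add_mul, add_tsub_cancel_of_le (hsε y x)]
  set δ : ℝ≥0 := 1 - ε with hδ
  have hup : normalizer μ w f y / normalizer μ w f' y ≤
      ε * ∫⁻ x, r x ∂μ + δ * ((1 + R) * a) := by
    rw [hsplit]
    gcongr
    rw [hδ, ← hmass y, ← lintegral_mul_const _ ((hsm y).sub_const _)]
    exact lintegral_mono fun x => mul_le_mul_right (hrb x) _
  have hlow : ε * ∫⁻ x, r x ∂μ + δ * a ≤ normalizer μ w f y' / normalizer μ w f' y' := by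
    rw [hsplit]
    gcongr
    rw [hδ, ← hmass y', ← lintegral_mul_const _ ((hsm y').sub_const _)]
    exact lintegral_mono fun x => mul_le_mul_right (hra x) _
  -- This converts the absolute increment `δ * R * a` into a relative one.
  have hal : a ≤ normalizer μ w f y' / normalizer μ w f' y' := by
    refine le_trans ?_ hlow
    calc a = ε * a + δ * a := by
          rw [← add_mul, ← ENNReal.coe_add, hδ, add_tsub_cancel_of_le hε1]; simp
      _ = ε * ∫⁻ _, a ∂μ + δ * a := by rw [lintegral_const, measure_univ, mul_one]
      _ ≤ _ := by gcongr with x; exact hra x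
  calc _ ≤ ε * ∫⁻ x, r x ∂μ + δ * ((1 + R) * a) := hup
    _ = (ε * ∫⁻ x, r x ∂μ + δ * a) + δ * R * a := by ring
    _ ≤ normalizer μ w f y' / normalizer μ w f' y' +
          δ * R * (normalizer μ w f y' / normalizer μ w f' y') := by gcongr
    _ = _ := by ring

end IsComparable

/-- Exchanging numerator and denominator preserves the relative spread of a ratio. -/
theorem div_le_mul_div_swap {S : Type*} {f f' : S → ℝ≥0∞} (h0 : ∀ x, f x ≠ 0)
    (h1 : ∀ x, f x ≠ ∞) {K : ℝ≥0∞} (hK : K ≠ ∞) (hK0 : K ≠ 0)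
    (h : ∀ x x', f' x / f x ≤ K * (f' x' / f x')) (x x' : S) :
    f x / f' x ≤ K * (f x' / f' x') := by
  have h2 := ENNReal.inv_le_inv.2 (h x' x)
  rw [ENNReal.mul_inv (Or.inl hK0) (Or.inl hK), ENNReal.inv_div (Or.inl (h1 _)) (Or.inl (h0 _)),
    ENNReal.inv_div (Or.inl (h1 _)) (Or.inl (h0 _))] at h2
  refine le_trans (le_of_eq ?_) (mul_le_mul_right h2 K)
  rw [← mul_assoc, ENNReal.mul_inv_cancel hK0 hK, one_mul]

/-- A density of small relative spread is close to `1`. -/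
theorem abs_log_le_of_le_mul (μ : Measure X) [IsProbabilityMeasure μ] {r : X → ℝ≥0∞} {R : ℝ≥0}
    (h1 : ∫⁻ x, r x ∂μ = 1)
    (h : ∀ x x', r x ≤ (1 + R) * r x') (x : X) :
    r x ≠ 0 ∧ r x ≠ ∞ ∧ |Real.log (r x).toReal| ≤ R := by
  have hR : (1 + R : ℝ≥0∞) ≠ ∞ := by simp
  -- Since the mean is one, averaging the spread bound in either variable places `r x` between `(1 +
  -- R)⁻¹` and `1 + R`; then `log (1 + R) ≤ R` concludes.
  have hup : r x ≤ 1 + R := by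
    calc r x = ∫⁻ _, r x ∂μ := by simp
      _ ≤ ∫⁻ x', (1 + R) * r x' ∂μ := lintegral_mono fun x' => h x x'
      _ = 1 + R := by rw [lintegral_const_mul' _ _ hR, h1, mul_one]
  have hlow : 1 ≤ (1 + R) * r x := by
    calc 1 = ∫⁻ x', r x' ∂μ := h1.symm
      _ ≤ ∫⁻ _, (1 + R) * r x ∂μ := lintegral_mono fun x' => h x' x
      _ = (1 + R) * r x := by simp
  have hr0 : r x ≠ 0 := fun h0 => by simp [h0] at hlow
  have hrt : r x ≠ ∞ := (hup.trans_lt hR.lt_top).ne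
  refine ⟨hr0, hrt, ?_⟩
  lift r x to ℝ≥0 using hrt with t
  have ht : 0 < (t : ℝ) := by
    have : t ≠ 0 := by simpa using hr0
    positivity
  have hup' : (t : ℝ) ≤ 1 + R := by exact_mod_cast hup
  have hlow' : 1 ≤ (1 + R) * (t : ℝ) := by exact_mod_cast hlow
  have hR1 : (0 : ℝ) < 1 + R := by positivity
  have hlog : Real.log (1 + R) ≤ R := by
    have := Real.log_le_sub_one_of_pos hR1
    linarith
  simp only [ENNReal.coe_toReal]
  rw [abs_le]
  constructor
  · have := Real.log_nonneg hlow'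
    rw [Real.log_mul hR1.ne' ht.ne'] at this
    linarith
  · exact (Real.log_le_log ht hup').trans hlog

end Sinkhorn

namespace Sinkhorn

/-! ### Sinkhorn potentials: half steps and geometric decay of consecutive ratios. -/

variable {X Y : Type*} [MeasurableSpace X] [MeasurableSpace Y]

/-- Version of `IsEntropyFunction.phiEntropy_contraction` for densities in `ℝ≥0∞`. -/
theorem IsEntropyFunction.phiEntropy_contraction_ennreal {Φ : ℝ≥0 → ℝ≥0 → EReal}
    (hΦ : IsEntropyFunction Φ) (μ : Measure X) [IsProbabilityMeasure μ] (η : Measure Y)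
    [IsProbabilityMeasure η] {s : X → Y → ℝ≥0∞} (hs : Measurable (Function.uncurry s))
    (hst : ∀ x y, s x y ≠ ∞)
    {ε : ℝ≥0} (hε1 : ε < 1) (hε : ∀ x y, ε ≤ s x y) (hs1 : ∀ y, ∫⁻ x, s x y ∂μ = 1)
    {f g : Y → ℝ≥0∞} (hf : Measurable f) (hg : Measurable g) (hft : ∀ y, f y ≠ ∞)
    (hgt : ∀ y, g y ≠ ∞) (hf1 : ∫⁻ y, f y ∂η = 1) (hg1 : ∫⁻ y, g y ∂η = 1)
    {F G : X → ℝ≥0∞} (hFt : ∀ x, F x ≠ ∞) (hGt : ∀ x, G x ≠ ∞)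
    (hF : ∀ x, ∫⁻ y, s x y * f y ∂η = F x) (hG : ∀ x, ∫⁻ y, s x y * g y ∂η = G x) :
    phiEntropy Φ (μ.withDensity F) (μ.withDensity G) ≤
      ((1 - ε : ℝ) : EReal) * phiEntropy Φ (η.withDensity f) (η.withDensity g) := by
  lift f to Y → ℝ≥0 using hft
  lift g to Y → ℝ≥0 using hgt
  lift F to X → ℝ≥0 using hFt
  lift G to X → ℝ≥0 using hGt
  obtain ⟨s, rfl⟩ : ∃ s' : X → Y → ℝ≥0, s = fun x y => (s' x y : ℝ≥0∞) :=
    ⟨fun x y => (s x y).toNNReal, by funext x y; rw [ENNReal.coe_toNNReal (hst x y)]⟩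
  refine hΦ.phiEntropy_contraction μ η (s := s) (f := f) (g := g) (F := F) (G := G) ?_ hε1
    (fun x y => ENNReal.coe_le_coe.1 (hε x y)) hs1 ?_ ?_ hf1 hg1 hF hG
  · simpa [Function.uncurry_def] using hs.ennreal_toNNReal
  · simpa using hf.ennreal_toNNReal
  · simpa using hg.ennreal_toNNReal

namespace IsComparable

variable {w : X → Y → ℝ≥0∞} {κ : ℝ≥0} {μ : Measure X} [IsProbabilityMeasure μ] {η : Measure Y}
  [IsProbabilityMeasure η]

/-- The integrand is the `X`-marginal of the joint density `normalizer μ w f y * w x y * f x`, whose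
integral in `x` is one for every `y`; Tonelli gives total mass one. -/
theorem lintegral_div_normalizer_normalizer (hw : IsComparable w κ) {f : X → ℝ≥0∞}
    (hf : IsPotential μ f) :
    ∫⁻ x, f x / normalizer η (fun y x => w x y) (normalizer μ w f) x ∂μ = 1 := by
  have hg := hw.isPotential_normalizer hf η
  have hm : Measurable fun p : X × Y => normalizer μ w f p.2 * w p.1 p.2 * f p.1 :=
    ((hg.measurable.comp measurable_snd).mul hw.measurable).mul (hf.measurable.comp measurable_fst)
  calc _ = ∫⁻ x, ∫⁻ y, normalizer μ w f y * w x y * f x ∂η ∂μ := by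
        refine lintegral_congr fun x => ?_
        rw [lintegral_mul_const' _ _ (hf.ne_top x), div_eq_mul_inv, mul_comm]
        unfold normalizer
        simp_rw [inv_inv, mul_comm]
    _ = ∫⁻ y, ∫⁻ x, normalizer μ w f y * w x y * f x ∂μ ∂η :=
        lintegral_lintegral_swap hm.aemeasurable
    _ = 1 := by
        simp_rw [hw.lintegral_normalizer_mul hf]
        simp

theorem inv_sq_lt_one (hw : IsComparable w κ) : (κ ^ 2)⁻¹ < 1 :=
  inv_lt_one_of_one_lt₀ (one_lt_pow₀ hw.one_lt two_ne_zero)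

/-- One half step of the Sinkhorn iterations contracts the `Φ`-entropies. -/
theorem phiEntropy_half_step {Φ : ℝ≥0 → ℝ≥0 → EReal} (hΦ : IsEntropyFunction Φ)
    (hw : IsComparable w κ) {b b' : Y → ℝ≥0∞} {a a' : X → ℝ≥0∞} (hb : IsPotential η b)
    (ha : a = normalizer η (fun y x => w x y) b) (hb' : b' = normalizer μ w a)
    (ha' : a' = normalizer η (fun y x => w x y) b') :
    phiEntropy Φ μ (μ.withDensity fun x => a x / a' x) ≤
        ((1 - (κ ^ 2)⁻¹ : ℝ) : EReal) * phiEntropy Φ (η.withDensity fun y => b y / b' y) η ∧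
      phiEntropy Φ (μ.withDensity fun x => a x / a' x) μ ≤
        ((1 - (κ ^ 2)⁻¹ : ℝ) : EReal) * phiEntropy Φ η (η.withDensity fun y => b y / b' y) := by
  have pa : IsPotential μ a := by rw [ha]; exact hw.swap.isPotential_normalizer hb μ
  have pb' : IsPotential η b' := by rw [hb']; exact hw.isPotential_normalizer pa η
  have pa' : IsPotential μ a' := by rw [ha']; exact hw.swap.isPotential_normalizer pb' μ
  have haκ : ∀ x x', a x ≤ κ * a x' := by
    rw [ha]; exact hw.swap.normalizer_le η b
  -- The density relative to `μ` of the transition from `Y` to `X`. By `hF` and `hG` it maps `b /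
  -- b'` to `1` and `1` to `a / a'`, so the target marginal and the iterate exchange places in the
  -- entropy.
  set s : X → Y → ℝ≥0∞ := fun x y => b' y * w x y * a x with hs
  have hsm : Measurable (Function.uncurry s) :=
    ((pb'.measurable.comp measurable_snd).mul hw.measurable).mul
      (pa.measurable.comp measurable_fst)
  have hst : ∀ x y, s x y ≠ ∞ := fun x y =>
    ENNReal.mul_ne_top (ENNReal.mul_ne_top (pb'.ne_top y) (hw.ne_top x y)) (pa.ne_top x)
  have hsε : ∀ x y, (((κ ^ 2)⁻¹ : ℝ≥0) : ℝ≥0∞) ≤ s x y := fun x y => by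
    rw [hs, hb']; exact hw.le_normalizer_mul pa haκ x y
  have hs1 : ∀ y, ∫⁻ x, s x y ∂μ = 1 := fun y => by
    rw [hs, hb']; exact hw.lintegral_normalizer_mul pa y
  have hbm : Measurable fun y => b y / b' y := hb.measurable.div pb'.measurable
  have hbt : ∀ y, b y / b' y ≠ ∞ := fun y => ENNReal.div_ne_top (hb.ne_top y) (pb'.ne_zero y)
  have hat : ∀ x, a x / a' x ≠ ∞ := fun x => ENNReal.div_ne_top (pa.ne_top x) (pa'.ne_zero x)
  have hb1 : ∫⁻ y, b y / b' y ∂η = 1 := by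
    rw [hb', ha]; exact hw.swap.lintegral_div_normalizer_normalizer hb
  have hF : ∀ x, ∫⁻ y, s x y * (b y / b' y) ∂η = 1 := by
    intro x
    rw [← hw.swap.lintegral_normalizer_mul hb x, ← ha]
    refine lintegral_congr fun y => ?_
    calc s x y * (b y / b' y) = a x * w x y * (b' y * (b y / b' y)) := by rw [hs]; ring
      _ = _ := by rw [ENNReal.mul_div_cancel (pb'.ne_zero y) (pb'.ne_top y)]
  have hG : ∀ x, ∫⁻ y, s x y * 1 ∂η = a x / a' x := by
    intro x
    simp only [mul_one, hs]
    rw [lintegral_mul_const' _ _ (pa.ne_top x), div_eq_mul_inv, mul_comm, ha']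
    unfold normalizer
    simp_rw [inv_inv, mul_comm]
  have h1 : ∫⁻ _, (1 : ℝ≥0∞) ∂η = 1 := by simp
  have e1 : μ.withDensity (fun _ => (1 : ℝ≥0∞)) = μ := withDensity_one
  have e2 : η.withDensity (fun _ => (1 : ℝ≥0∞)) = η := withDensity_one
  have c1 := hΦ.phiEntropy_contraction_ennreal μ η hsm hst hw.inv_sq_lt_one hsε hs1 hbm
    measurable_const hbt (fun _ => ENNReal.one_ne_top) hb1 h1 (fun _ => ENNReal.one_ne_top) hat
    hF hG
  have c2 := hΦ.phiEntropy_contraction_ennreal μ η hsm hst hw.inv_sq_lt_one hsε hs1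
    measurable_const hbm (fun _ => ENNReal.one_ne_top) hbt h1 hb1 hat (fun _ => ENNReal.one_ne_top)
    hG hF
  rw [e1, e2] at c1 c2
  push_cast at c1 c2
  exact ⟨c1, c2⟩

end IsComparable

/-- The Sinkhorn potentials on `Y`, started at `b`. -/
noncomputable def potentialY (μ : Measure X) (η : Measure Y) (w : X → Y → ℝ≥0∞) (b : Y → ℝ≥0∞) :
    ℕ → Y → ℝ≥0∞
  | 0 => b
  | n + 1 => normalizer μ w (normalizer η (fun y x => w x y) (potentialY μ η w b n))

/-- The Sinkhorn potentials on `X`. -/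
noncomputable def potentialX (μ : Measure X) (η : Measure Y) (w : X → Y → ℝ≥0∞) (b : Y → ℝ≥0∞)
    (n : ℕ) : X → ℝ≥0∞ :=
  normalizer η (fun y x => w x y) (potentialY μ η w b n)

theorem potentialY_succ (μ : Measure X) (η : Measure Y) (w : X → Y → ℝ≥0∞) (b : Y → ℝ≥0∞)
    (n : ℕ) : potentialY μ η w b (n + 1) = normalizer μ w (potentialX μ η w b n) := rfl

namespace IsComparable

theorem potentialX_le {w : X → Y → ℝ≥0∞} {κ : ℝ≥0} (hw : IsComparable w κ)
    {μ : Measure X} {η : Measure Y} {b : Y → ℝ≥0∞} (n : ℕ) (x x' : X) :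
    potentialX μ η w b n x ≤ κ * potentialX μ η w b n x' :=
  hw.swap.normalizer_le _ _ x x'

theorem potentialY_succ_le {w : X → Y → ℝ≥0∞} {κ : ℝ≥0} (hw : IsComparable w κ)
    {μ : Measure X} {η : Measure Y} {b : Y → ℝ≥0∞} (n : ℕ) (y y' : Y) :
    potentialY μ η w b (n + 1) y ≤ κ * potentialY μ η w b (n + 1) y' :=
  hw.normalizer_le _ _ y y'

variable {w : X → Y → ℝ≥0∞} {κ : ℝ≥0} {μ : Measure X} [IsProbabilityMeasure μ] {η : Measure Y}
  [IsProbabilityMeasure η] {b : Y → ℝ≥0∞}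

theorem isPotential_potentialY (hw : IsComparable w κ) (hb : IsPotential η b) (n : ℕ) :
    IsPotential η (potentialY μ η w b n) := by
  induction n with
  | zero => exact hb
  | succ n ih => exact hw.isPotential_normalizer (hw.swap.isPotential_normalizer ih μ) η

theorem isPotential_potentialX (hw : IsComparable w κ) (hb : IsPotential η b) (n : ℕ) :
    IsPotential μ (potentialX μ η w b n) :=
  hw.swap.isPotential_normalizer (hw.isPotential_potentialY hb n) μ

theorem lintegral_potentialX_div (hw : IsComparable w κ) (hb : IsPotential η b) (n : ℕ) :
    ∫⁻ x, potentialX μ η w b n x / potentialX μ η w b (n + 1) x ∂μ = 1 :=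
  hw.lintegral_div_normalizer_normalizer (hw.isPotential_potentialX hb n)

theorem lintegral_potentialY_div (hw : IsComparable w κ) (hb : IsPotential η b) (n : ℕ) :
    ∫⁻ y, potentialY μ η w b n y / potentialY μ η w b (n + 1) y ∂η = 1 :=
  hw.swap.lintegral_div_normalizer_normalizer (hw.isPotential_potentialY hb n)

/-- Normalization averages the inverse ratio, and inversion does not change the relative spread; the
averaging contributes the factor `1 - κ⁻²`. -/
theorem potentialY_div_le_of_potentialX_div_le (hw : IsComparable w κ) (hb : IsPotential η b)
    {n : ℕ} {R : ℝ≥0∞} (hR : R ≠ ∞)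
    (h : ∀ x x', potentialX μ η w b n x / potentialX μ η w b (n + 1) x ≤
      (1 + R) * (potentialX μ η w b n x' / potentialX μ η w b (n + 1) x')) (y y' : Y) :
    potentialY μ η w b (n + 1) y / potentialY μ η w b (n + 2) y ≤
      (1 + ((1 - (κ ^ 2)⁻¹ : ℝ≥0) : ℝ≥0∞) * R) *
        (potentialY μ η w b (n + 1) y' / potentialY μ η w b (n + 2) y') := by
  have p := hw.isPotential_potentialX (μ := μ) hb n
  have p' := hw.isPotential_potentialX (μ := μ) hb (n + 1)
  exact hw.normalizer_div_normalizer_le p (hw.potentialX_le n) p'.measurable hR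
    (div_le_mul_div_swap p'.ne_zero p'.ne_top (ENNReal.add_ne_top.2 ⟨ENNReal.one_ne_top, hR⟩)
      (by simp) h) y y'

/-- The index on `Y` starts at one: `b` itself may have infinite spread, whereas the later
potentials are normalizers. -/
theorem potentialX_div_le_of_potentialY_div_le (hw : IsComparable w κ) (hb : IsPotential η b)
    {n : ℕ} {R : ℝ≥0∞} (hR : R ≠ ∞)
    (h : ∀ y y', potentialY μ η w b (n + 1) y / potentialY μ η w b (n + 2) y ≤
      (1 + R) * (potentialY μ η w b (n + 1) y' / potentialY μ η w b (n + 2) y')) (x x' : X) :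
    potentialX μ η w b (n + 1) x / potentialX μ η w b (n + 2) x ≤
      (1 + ((1 - (κ ^ 2)⁻¹ : ℝ≥0) : ℝ≥0∞) * R) *
        (potentialX μ η w b (n + 1) x' / potentialX μ η w b (n + 2) x') := by
  have p := hw.isPotential_potentialY (μ := μ) hb (n + 1)
  have p' := hw.isPotential_potentialY (μ := μ) hb (n + 2)
  exact hw.swap.normalizer_div_normalizer_le p (hw.potentialY_succ_le n) p'.measurable hR
    (div_le_mul_div_swap p'.ne_zero p'.ne_top (ENNReal.add_ne_top.2 ⟨ENNReal.one_ne_top, hR⟩)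
      (by simp) h) x x'

/-- All potentials on `X` are normalizers, of spread at most `κ`, so the first ratio has spread at
most `κ²`. Each index then adds two half steps, each with factor `1 - κ⁻²`. -/
theorem potentialX_div_le (hw : IsComparable w κ) (hb : IsPotential η b) (n : ℕ) (x x' : X) :
    potentialX μ η w b n x / potentialX μ η w b (n + 1) x ≤
      (1 + (((1 - (κ ^ 2)⁻¹) ^ (2 * n) * κ ^ 2 : ℝ≥0) : ℝ≥0∞)) *
        (potentialX μ η w b n x' / potentialX μ η w b (n + 1) x') := by
  induction n generalizing x x' with
  | zero =>
    have p := hw.isPotential_potentialX (μ := μ) hb 0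
    have p' := hw.isPotential_potentialX (μ := μ) hb 1
    rw [mul_zero, pow_zero, one_mul, zero_add]
    have h1 := hw.potentialX_le (μ := μ) (η := η) (b := b) 0 x x'
    have h2 := ENNReal.inv_le_inv.2 (hw.potentialX_le (μ := μ) (η := η) (b := b) 1 x' x)
    rw [ENNReal.mul_inv (Or.inl hw.coe_ne_zero) (Or.inl ENNReal.coe_ne_top)] at h2
    have h3 : (potentialX μ η w b 1 x)⁻¹ ≤ κ * (potentialX μ η w b 1 x')⁻¹ := by
      refine le_trans (le_of_eq ?_) (mul_le_mul_right h2 (κ : ℝ≥0∞))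
      rw [← mul_assoc, ENNReal.mul_inv_cancel hw.coe_ne_zero ENNReal.coe_ne_top, one_mul]
    simp_rw [div_eq_mul_inv]
    calc _ ≤ (κ * potentialX μ η w b 0 x') * (κ * (potentialX μ η w b 1 x')⁻¹) := by gcongr
      _ = (κ ^ 2 : ℝ≥0) * (potentialX μ η w b 0 x' * (potentialX μ η w b 1 x')⁻¹) := by
        push_cast; ring
      _ ≤ _ := by gcongr; exact le_add_self
  | succ n ih =>
    have h := hw.potentialX_div_le_of_potentialY_div_le (μ := μ) (η := η) hb
      (ENNReal.mul_ne_top ENNReal.coe_ne_top ENNReal.coe_ne_top)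
      (hw.potentialY_div_le_of_potentialX_div_le hb ENNReal.coe_ne_top ih) x x'
    convert h using 3
    push_cast
    ring

theorem potentialY_div_le (hw : IsComparable w κ) (hb : IsPotential η b) (n : ℕ) (y y' : Y) :
    potentialY μ η w b (n + 1) y / potentialY μ η w b (n + 2) y ≤
      (1 + (((1 - (κ ^ 2)⁻¹) ^ (2 * n + 1) * κ ^ 2 : ℝ≥0) : ℝ≥0∞)) *
        (potentialY μ η w b (n + 1) y' / potentialY μ η w b (n + 2) y') := by
  have h := hw.potentialY_div_le_of_potentialX_div_le (μ := μ) (η := η) hb ENNReal.coe_ne_top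
    (hw.potentialX_div_le hb n) y y'
  convert h using 3
  push_cast
  ring

/-- Geometric decay of the logarithms of the ratios of consecutive potentials on `X`. -/
theorem abs_log_potentialX_div_le (hw : IsComparable w κ) (hb : IsPotential η b) (n : ℕ) (x : X) :
    |Real.log (potentialX μ η w b n x / potentialX μ η w b (n + 1) x).toReal| ≤
      κ ^ 2 * ((1 - (κ ^ 2)⁻¹) ^ 2 : ℝ) ^ n := by
  have h := (abs_log_le_of_le_mul μ (hw.lintegral_potentialX_div hb n)
    (hw.potentialX_div_le hb n) x).2.2
  refine h.trans_eq ?_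
  push_cast [NNReal.coe_sub hw.inv_sq_lt_one.le]
  rw [← pow_mul, mul_comm]

/-- Geometric decay of the logarithms of the ratios of consecutive potentials on `Y`. -/
theorem abs_log_potentialY_div_le (hw : IsComparable w κ) (hb : IsPotential η b) (n : ℕ) (y : Y) :
    |Real.log (potentialY μ η w b (n + 1) y / potentialY μ η w b (n + 2) y).toReal| ≤
      κ ^ 2 * ((1 - (κ ^ 2)⁻¹) ^ 2 : ℝ) ^ n := by
  have h := (abs_log_le_of_le_mul η (hw.lintegral_potentialY_div (μ := μ) hb (n + 1))
    (hw.potentialY_div_le hb n) y).2.2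
  have h1 : (κ ^ 2 : ℝ)⁻¹ < 1 := by exact_mod_cast hw.inv_sq_lt_one
  have h0 : (0 : ℝ) ≤ (κ ^ 2 : ℝ)⁻¹ := by positivity
  refine h.trans ?_
  push_cast [NNReal.coe_sub hw.inv_sq_lt_one.le]
  rw [← pow_mul, mul_comm]
  -- The exponent `2 * n + 1` is lowered to `2 * n`, so that both spaces share the same bound.
  exact mul_le_mul_of_nonneg_left
    (pow_le_pow_of_le_one (sub_nonneg.2 h1.le) (sub_le_self _ h0) (Nat.le_succ _)) (by positivity)

end IsComparable
end Sinkhorn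

/-! ### Bridges and marginals as densities relative to the product measure. -/

namespace Sinkhorn

section Density

variable {X Y : Type*} [MeasurableSpace X] [MeasurableSpace Y]

theorem withDensity_compProd_eq (π : Measure X) [SFinite π] (K : Kernel X Y) [IsSFiniteKernel K]
    {h : X → ℝ≥0∞} (hh : Measurable h) [SFinite (π.withDensity h)] :
    (π.withDensity h) ⊗ₘ K = (π ⊗ₘ K).withDensity fun p => h p.1 := by
  refine Measure.ext_of_lintegral _ fun g hg => ?_
  rw [Measure.lintegral_compProd hg, lintegral_withDensity_eq_lintegral_mul _ hh (by fun_prop),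
    lintegral_withDensity_eq_lintegral_mul _ (by fun_prop) hg,
    Measure.lintegral_compProd (by fun_prop)]
  refine lintegral_congr fun x => ?_
  simp only [Pi.mul_apply]
  rw [lintegral_const_mul _ (by fun_prop)]

theorem map_swap_withDensity (P : Measure (X × Y)) {h : X × Y → ℝ≥0∞} (hh : Measurable h) :
    (P.withDensity h).map Prod.swap = (P.map Prod.swap).withDensity fun p => h p.swap := by
  refine Measure.ext_of_lintegral _ fun g hg => ?_
  rw [lintegral_map hg measurable_swap, lintegral_withDensity_eq_lintegral_mul _ hh (by fun_prop),
    lintegral_withDensity_eq_lintegral_mul _ (by fun_prop) hg,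
    lintegral_map (by fun_prop) measurable_swap]
  simp

theorem snd_prod_withDensity (μ : Measure X) [SFinite μ] (η : Measure Y) [SFinite η]
    {h : X × Y → ℝ≥0∞} (hh : Measurable h) :
    ((μ.prod η).withDensity h).snd = η.withDensity fun y => ∫⁻ x, h (x, y) ∂μ := by
  refine Measure.ext_of_lintegral _ fun g hg => ?_
  have hm : Measurable fun y => ∫⁻ x, h (x, y) ∂μ := hh.lintegral_prod_left'
  unfold Measure.snd
  rw [lintegral_map hg measurable_snd, lintegral_withDensity_eq_lintegral_mul _ hh (by fun_prop),
    lintegral_withDensity_eq_lintegral_mul _ hm hg, lintegral_prod_symm' _ (by fun_prop)]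
  refine lintegral_congr fun y => ?_
  simp only [Pi.mul_apply]
  rw [lintegral_mul_const _ (by fun_prop)]

theorem fst_prod_withDensity (μ : Measure X) [SFinite μ] (η : Measure Y) [SFinite η]
    {h : X × Y → ℝ≥0∞} (hh : Measurable h) :
    ((μ.prod η).withDensity h).fst = μ.withDensity fun x => ∫⁻ y, h (x, y) ∂η := by
  refine Measure.ext_of_lintegral _ fun g hg => ?_
  have hm : Measurable fun x => ∫⁻ y, h (x, y) ∂η := hh.lintegral_prod_right'
  unfold Measure.fst
  rw [lintegral_map hg measurable_fst, lintegral_withDensity_eq_lintegral_mul _ hh (by fun_prop),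
    lintegral_withDensity_eq_lintegral_mul _ hm hg, lintegral_prod _ (by fun_prop)]
  refine lintegral_congr fun y => ?_
  simp only [Pi.mul_apply]
  rw [lintegral_mul_const _ (by fun_prop)]

/-- Recovers the target marginal from an iterate, e.g. `ν_V` from `π_{2n}`, so that a kernel
disintegrating over one can be recombined with the other. -/
theorem withDensity_div_withDensity_div (γ : Measure X) {f g : X → ℝ≥0∞} (hf : Measurable f)
    (hg : Measurable g) (hf0 : ∀ x, f x ≠ 0) (hft : ∀ x, f x ≠ ∞) (hg0 : ∀ x, g x ≠ 0)
    (hgt : ∀ x, g x ≠ ∞) :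
    (γ.withDensity fun x => f x / g x).withDensity (fun x => g x / f x) = γ := by
  rw [← withDensity_mul γ (f := fun x => f x / g x) (g := fun x => g x / f x) (hf.div hg)
    (hg.div hf)]
  refine Eq.trans ?_ (withDensity_one (μ := γ))
  congr 1
  funext x
  simp only [Pi.mul_apply, Pi.one_apply]
  rw [← ENNReal.inv_div (Or.inl (hgt x)) (Or.inl (hg0 x)), ENNReal.mul_inv_cancel]
  · exact ENNReal.div_ne_zero.2 ⟨hf0 x, hgt x⟩
  · exact ENNReal.div_ne_top (hft x) (hg0 x)

variable {w : X → Y → ℝ≥0∞} {κ : ℝ≥0} {f : X → ℝ≥0∞} {g : Y → ℝ≥0∞}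

theorem IsComparable.measurable_density (hw : IsComparable w κ)
    (hf : Measurable f) (hg : Measurable g) :
    Measurable fun p : X × Y => f p.1 * w p.1 p.2 * g p.2 :=
  ((hf.comp measurable_fst).mul hw.measurable).mul (hg.comp measurable_snd)

/-- The marginal has density one exactly when `g` is the normalizer of `f`; this is why fitting a
marginal amounts to normalizing a potential. -/
theorem IsComparable.snd_density (μ : Measure X) [SFinite μ] (η : Measure Y) [SFinite η]
    (hw : IsComparable w κ) (hf : Measurable f) (hg : Measurable g) :
    ((μ.prod η).withDensity fun p => f p.1 * w p.1 p.2 * g p.2).snd =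
      η.withDensity fun y => g y / normalizer μ w f y := by
  rw [snd_prod_withDensity _ _ (hw.measurable_density hf hg)]
  congr 1
  funext y
  have := hw.measurable_left y
  change ∫⁻ x, f x * w x y * g y ∂μ = _
  rw [lintegral_mul_const _ (by fun_prop), mul_comm, div_eq_mul_inv]
  unfold normalizer
  simp_rw [inv_inv, mul_comm]

theorem IsComparable.fst_density (μ : Measure X) [SFinite μ] (η : Measure Y) [SFinite η]
    (hw : IsComparable w κ) (hf : Measurable f) (hg : Measurable g) :
    ((μ.prod η).withDensity fun p => f p.1 * w p.1 p.2 * g p.2).fst =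
      μ.withDensity fun x => f x / normalizer η (fun y x => w x y) g x := by
  rw [fst_prod_withDensity _ _ (hw.measurable_density hf hg)]
  congr 1
  funext x
  have := hw.swap.measurable_left x
  change ∫⁻ y, f x * w x y * g y ∂η = _
  simp_rw [mul_assoc]
  rw [lintegral_const_mul _ (by fun_prop), div_eq_mul_inv]
  unfold normalizer
  simp_rw [inv_inv]

end Density

variable {X Y : Type*} [MeasurableSpace X] [StandardBorelSpace X] [Nonempty X]
  [MeasurableSpace Y] [StandardBorelSpace Y] [Nonempty Y]
  {μ : Measure X} [IsProbabilityMeasure μ] {η : Measure Y} [IsProbabilityMeasure η]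
  {Q : Kernel X Y} [IsMarkovKernel Q] {w : X → Y → ℝ≥0∞} {κ : ℝ≥0} {b : Y → ℝ≥0∞}

namespace IsComparable

/-- The Sinkhorn bridges in terms of the potentials. -/
theorem bridges_eq (hw : IsComparable w κ) (hb : IsPotential η b)
    (hQ : μ ⊗ₘ Q = (μ.prod η).withDensity fun p => potentialX μ η w b 0 p.1 * w p.1 p.2 * b p.2)
    (n : ℕ) :
    bridgeEven μ η Q n = ((μ.prod η).withDensity fun p =>
        potentialX μ η w b n p.1 * w p.1 p.2 * potentialY μ η w b n p.2) ∧
      piEven μ η Q n =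
        (η.withDensity fun y => potentialY μ η w b n y / potentialY μ η w b (n + 1) y) ∧
      piOdd μ η Q n =
        (μ.withDensity fun x => potentialX μ η w b n x / potentialX μ η w b (n + 1) x) ∧
      piOdd μ η Q n ⊗ₘ evenKernel μ η Q (n + 1) = ((μ.prod η).withDensity fun p =>
        potentialX μ η w b n p.1 * w p.1 p.2 * potentialY μ η w b (n + 1) p.2) := by
  have pX : ∀ n, IsPotential μ (potentialX μ η w b n) := hw.isPotential_potentialX hb
  have pY : ∀ n, IsPotential η (potentialY μ η w b n) := hw.isPotential_potentialY hb
  -- The last clause writes the odd bridge through `𝒮_{2n+2}`, the form from which the induction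
  -- builds the next even bridge.
  have main : ∀ n, bridgeEven μ η Q n = ((μ.prod η).withDensity fun p =>
        potentialX μ η w b n p.1 * w p.1 p.2 * potentialY μ η w b n p.2) →
      piEven μ η Q n =
        (η.withDensity fun y => potentialY μ η w b n y / potentialY μ η w b (n + 1) y) ∧
      piOdd μ η Q n =
        (μ.withDensity fun x => potentialX μ η w b n x / potentialX μ η w b (n + 1) x) ∧
      piOdd μ η Q n ⊗ₘ evenKernel μ η Q (n + 1) = ((μ.prod η).withDensity fun p =>
        potentialX μ η w b n p.1 * w p.1 p.2 * potentialY μ η w b (n + 1) p.2) := by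
    intro n h
    have hwm : Measurable fun p : X × Y => w p.1 p.2 := hw.measurable
    have mX := (pX n).measurable
    have mY := (pY n).measurable
    have mY' := (pY (n + 1)).measurable
    have e1 : piEven μ η Q n =
        (η.withDensity fun y => potentialY μ η w b n y / potentialY μ η w b (n + 1) y) := by
      unfold piEven
      rw [← Measure.snd_compProd]
      change (bridgeEven μ η Q n).snd = _
      rw [h, hw.snd_density μ η mX mY, potentialY_succ]
    have e2 : η = (piEven μ η Q n).withDensity
        fun y => potentialY μ η w b (n + 1) y / potentialY μ η w b n y := by
      rw [e1, withDensity_div_withDensity_div _ mY mY' (pY n).ne_zero (pY n).ne_top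
        (pY (n + 1)).ne_zero (pY (n + 1)).ne_top]
    have hprob : IsProbabilityMeasure (piEven μ η Q n) := by unfold piEven; infer_instance
    have hprob' : IsProbabilityMeasure ((piEven μ η Q n).withDensity
        fun y => potentialY μ η w b (n + 1) y / potentialY μ η w b n y) := by
      rw [← e2]; infer_instance
    have e3 : bridgeOdd μ η Q n = ((μ.prod η).withDensity fun p =>
        potentialX μ η w b n p.1 * w p.1 p.2 * potentialY μ η w b (n + 1) p.2) := by
      -- Exchanging the base measure under a fixed kernel multiplies the joint density by a function
      -- of `y` alone, which replaces `b_n` by `b_{n+1}`.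
      have e4 : η ⊗ₘ oddKernel μ η Q n = (piEven μ η Q n ⊗ₘ oddKernel μ η Q n).withDensity
          fun p => potentialY μ η w b (n + 1) p.1 / potentialY μ η w b n p.1 := by
        rw [← withDensity_compProd_eq _ _
          (h := fun y => potentialY μ η w b (n + 1) y / potentialY μ η w b n y) (mY'.div mY)]
        exact congrArg (fun m => m ⊗ₘ oddKernel μ η Q n) e2
      unfold bridgeOdd
      rw [e4, map_swap_withDensity _ (by fun_prop), piEven_compProd_oddKernel, h,
        ← withDensity_mul _ (by fun_prop) (by fun_prop)]
      congr 1
      funext p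
      simp only [Pi.mul_apply, Prod.fst_swap]
      rw [mul_assoc, ENNReal.mul_div_cancel ((pY n).ne_zero _) ((pY n).ne_top _)]
    refine ⟨e1, ?_, ?_⟩
    · have : piOdd μ η Q n = (bridgeOdd μ η Q n).fst := by
        unfold piOdd bridgeOdd
        rw [Measure.fst_map_swap, Measure.snd_compProd]
      rw [this, e3, hw.fst_density μ η mX mY']
      rfl
    · rw [piOdd_compProd_evenKernel, e3]
  suffices h : ∀ n, bridgeEven μ η Q n = ((μ.prod η).withDensity fun p =>
        potentialX μ η w b n p.1 * w p.1 p.2 * potentialY μ η w b n p.2) from ⟨h n, main n (h n)⟩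
  intro n
  induction n with
  | zero => exact hQ
  | succ n ih =>
    obtain ⟨-, h2, h3⟩ := main n ih
    have hwm : Measurable fun p : X × Y => w p.1 p.2 := hw.measurable
    have mX := (pX n).measurable
    have mX' := (pX (n + 1)).measurable
    have mY' := (pY (n + 1)).measurable
    have hprob : IsProbabilityMeasure (piOdd μ η Q n) := by unfold piOdd; infer_instance
    have e2 : μ = (piOdd μ η Q n).withDensity
        fun x => potentialX μ η w b (n + 1) x / potentialX μ η w b n x := by
      rw [h2, withDensity_div_withDensity_div _ mX mX' (pX n).ne_zero (pX n).ne_top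
        (pX (n + 1)).ne_zero (pX (n + 1)).ne_top]
    have hprob' : IsProbabilityMeasure ((piOdd μ η Q n).withDensity
        fun x => potentialX μ η w b (n + 1) x / potentialX μ η w b n x) := by
      rw [← e2]; infer_instance
    have e4 : bridgeEven μ η Q (n + 1) =
        (piOdd μ η Q n ⊗ₘ evenKernel μ η Q (n + 1)).withDensity
          fun p => potentialX μ η w b (n + 1) p.1 / potentialX μ η w b n p.1 := by
      rw [← withDensity_compProd_eq _ _
        (h := fun x => potentialX μ η w b (n + 1) x / potentialX μ η w b n x) (mX'.div mX)]
      exact congrArg (fun m => m ⊗ₘ evenKernel μ η Q (n + 1)) e2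
    rw [e4, h3, ← withDensity_mul _ (by fun_prop) (by fun_prop)]
    congr 1
    funext p
    simp only [Pi.mul_apply]
    calc _ = potentialX μ η w b n p.1 * (potentialX μ η w b (n + 1) p.1 /
          potentialX μ η w b n p.1) * w p.1 p.2 * potentialY μ η w b (n + 1) p.2 := by ring
      _ = _ := by rw [ENNReal.mul_div_cancel ((pX n).ne_zero _) ((pX n).ne_top _)]

theorem bridgeEven_eq (hw : IsComparable w κ) (hb : IsPotential η b)
    (hQ : μ ⊗ₘ Q = (μ.prod η).withDensity fun p => potentialX μ η w b 0 p.1 * w p.1 p.2 * b p.2)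
    (n : ℕ) :
    bridgeEven μ η Q n = (μ.prod η).withDensity fun p =>
      potentialX μ η w b n p.1 * w p.1 p.2 * potentialY μ η w b n p.2 :=
  (hw.bridges_eq hb hQ n).1

theorem piEven_eq (hw : IsComparable w κ) (hb : IsPotential η b)
    (hQ : μ ⊗ₘ Q = (μ.prod η).withDensity fun p => potentialX μ η w b 0 p.1 * w p.1 p.2 * b p.2)
    (n : ℕ) :
    piEven μ η Q n =
      η.withDensity fun y => potentialY μ η w b n y / potentialY μ η w b (n + 1) y :=
  (hw.bridges_eq hb hQ n).2.1

theorem piOdd_eq (hw : IsComparable w κ) (hb : IsPotential η b)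
    (hQ : μ ⊗ₘ Q = (μ.prod η).withDensity fun p => potentialX μ η w b 0 p.1 * w p.1 p.2 * b p.2)
    (n : ℕ) :
    piOdd μ η Q n =
      μ.withDensity fun x => potentialX μ η w b n x / potentialX μ η w b (n + 1) x :=
  (hw.bridges_eq hb hQ n).2.2.1

end IsComparable

/-! ### Decay of the entropies and of the log-densities -/

theorem le_pow_mul_of_le_mul {D : ℕ → EReal} {ρ : ℝ} (hρ : 0 ≤ ρ)
    (h : ∀ n, D (n + 1) ≤ (ρ : EReal) * D n) (n : ℕ) : D n ≤ ((ρ ^ n : ℝ) : EReal) * D 0 := by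
  induction n with
  | zero => simp
  | succ n ih =>
    refine (h n).trans ((mul_le_mul_of_nonneg_left ih (by exact_mod_cast hρ)).trans_eq ?_)
    rw [← mul_assoc, ← EReal.coe_mul, pow_succ']

namespace IsComparable

/-- A half step reverses the order of target and iterate, and two of them restore it. Hence the four
sequences couple in crossed pairs, each with factor `(1 - κ⁻²)²` per index. -/
theorem phiEntropy_iterates_le (hw : IsComparable w κ) (hb : IsPotential η b)
    (hQ : μ ⊗ₘ Q = (μ.prod η).withDensity fun p => potentialX μ η w b 0 p.1 * w p.1 p.2 * b p.2)
    {Φ : ℝ≥0 → ℝ≥0 → EReal} (hΦ : IsEntropyFunction Φ) (n : ℕ) :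
    phiEntropy Φ (piEven μ η Q n) η ≤
        ((((1 - (κ ^ 2)⁻¹) ^ 2) ^ n : ℝ) : EReal) * phiEntropy Φ (piEven μ η Q 0) η ∧
      phiEntropy Φ η (piEven μ η Q n) ≤
        ((((1 - (κ ^ 2)⁻¹) ^ 2) ^ n : ℝ) : EReal) * phiEntropy Φ η (piEven μ η Q 0) ∧
      phiEntropy Φ μ (piOdd μ η Q n) ≤
        ((((1 - (κ ^ 2)⁻¹) ^ 2) ^ n : ℝ) : EReal) * phiEntropy Φ μ (piOdd μ η Q 0) ∧
      phiEntropy Φ (piOdd μ η Q n) μ ≤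
        ((((1 - (κ ^ 2)⁻¹) ^ 2) ^ n : ℝ) : EReal) * phiEntropy Φ (piOdd μ η Q 0) μ := by
  have hδ : (0 : ℝ) ≤ 1 - ((κ : ℝ) ^ 2)⁻¹ := by
    have : ((κ : ℝ) ^ 2)⁻¹ < 1 := by exact_mod_cast hw.inv_sq_lt_one
    linarith
  have hδ' : (0 : EReal) ≤ ((1 - ((κ : ℝ) ^ 2)⁻¹ : ℝ) : EReal) := by exact_mod_cast hδ
  have comb : ∀ {a b c : EReal}, a ≤ ((1 - ((κ : ℝ) ^ 2)⁻¹ : ℝ) : EReal) * b →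
      b ≤ ((1 - ((κ : ℝ) ^ 2)⁻¹ : ℝ) : EReal) * c →
      a ≤ (((1 - ((κ : ℝ) ^ 2)⁻¹) ^ 2 : ℝ) : EReal) * c := by
    intro a b c h1 h2
    refine h1.trans ((mul_le_mul_of_nonneg_left h2 hδ').trans_eq ?_)
    rw [← mul_assoc, ← EReal.coe_mul, ← sq]
  have stepX : ∀ n, _ := fun n => IsComparable.phiEntropy_half_step hΦ hw
    (hw.isPotential_potentialY (μ := μ) hb n) (a := potentialX μ η w b n)
    (b' := potentialY μ η w b (n + 1)) (a' := potentialX μ η w b (n + 1)) rfl rfl rfl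
  have stepY : ∀ n, _ := fun n => IsComparable.phiEntropy_half_step hΦ hw.swap
    (hw.isPotential_potentialX (η := η) hb n) (a := potentialY μ η w b (n + 1))
    (b' := potentialX μ η w b (n + 1)) (a' := potentialY μ η w b (n + 2)) rfl rfl rfl
  simp_rw [hw.piEven_eq hb hQ, hw.piOdd_eq hb hQ]
  refine ⟨le_pow_mul_of_le_mul (D := fun n => phiEntropy Φ (η.withDensity fun y =>
      potentialY μ η w b n y / potentialY μ η w b (n + 1) y) η) (by positivity)
      (fun n => comb (stepY n).2 (stepX n).1) n,
    le_pow_mul_of_le_mul (D := fun n => phiEntropy Φ η (η.withDensity fun y =>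
      potentialY μ η w b n y / potentialY μ η w b (n + 1) y)) (by positivity)
      (fun n => comb (stepY n).1 (stepX n).2) n,
    le_pow_mul_of_le_mul (D := fun n => phiEntropy Φ μ (μ.withDensity fun x =>
      potentialX μ η w b n x / potentialX μ η w b (n + 1) x)) (by positivity)
      (fun n => comb (stepX (n + 1)).1 (stepY n).2) n,
    le_pow_mul_of_le_mul (D := fun n => phiEntropy Φ (μ.withDensity fun x =>
      potentialX μ η w b n x / potentialX μ η w b (n + 1) x) μ) (by positivity)
      (fun n => comb (stepX (n + 1)).2 (stepY n).1) n⟩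

end IsComparable

/-- A density with bounded logarithm gives mutual absolute continuity and bounded log-densities. -/
theorem logDensityBound_withDensity {S : Type*} [MeasurableSpace S] (γ : Measure S)
    [IsProbabilityMeasure γ] {r : S → ℝ≥0∞} (hr : Measurable r) (hr0 : ∀ x, r x ≠ 0)
    (hrt : ∀ x, r x ≠ ∞) {B : ℝ} (h : ∀ᵐ x ∂γ, |Real.log (r x).toReal| ≤ B) :
    LogDensityBound (γ.withDensity r) γ B ∧ LogDensityBound γ (γ.withDensity r) B := by
  have hlog : ∀ x, |Real.log (r x).toReal| ≤ B →
      (ENNReal.log (r x)).abs ≤ ENNReal.ofReal B := by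
    intro x hx
    rw [ENNReal.log_pos_real (hr0 x) (hrt x), EReal.abs_def]
    exact ENNReal.ofReal_le_ofReal hx
  have hlog' : ∀ x, |Real.log (r x).toReal| ≤ B →
      (ENNReal.log (r x)⁻¹).abs ≤ ENNReal.ofReal B := by
    intro x hx
    rw [ENNReal.log_inv, EReal.abs_neg]
    exact hlog x hx
  have hac : γ ≪ γ.withDensity r :=
    withDensity_absolutelyContinuous' hr.aemeasurable (ae_of_all _ hr0)
  have hac' : γ.withDensity r ≪ γ := withDensity_absolutelyContinuous _ _
  have hsf : SigmaFinite (γ.withDensity r) :=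
    SigmaFinite.withDensity_of_ne_top (ae_of_all _ hrt)
  refine ⟨⟨hac', essSup_le_of_ae_le _ ?_⟩, ⟨hac, essSup_le_of_ae_le _ ?_⟩⟩
  · filter_upwards [Measure.rnDeriv_withDensity γ hr, h] with x h1 h2
    rw [h1]
    exact hlog x h2
  · have h3 : (γ.withDensity r).rnDeriv γ =ᵐ[γ.withDensity r] r :=
      hac'.ae_eq (Measure.rnDeriv_withDensity γ hr)
    filter_upwards [h3, hac'.ae_le h, Measure.inv_rnDeriv hac'] with x h1 h2 h4
    rw [← h4, Pi.inv_apply, h1]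
    exact hlog' x h2

end Sinkhorn

namespace Sinkhorn

open Filter Topology InformationTheory

/-! ### Limits of the potentials -/

theorem le_ofReal_exp_mul_of_log_sub_log_le {a b : ℝ≥0∞} (ha0 : a ≠ 0) (hat : a ≠ ∞)
    (hb0 : b ≠ 0) (hbt : b ≠ ∞) {c : ℝ} (h : Real.log a.toReal - Real.log b.toReal ≤ c) :
    a ≤ ENNReal.ofReal (Real.exp c) * b := by
  have ha := ENNReal.toReal_pos ha0 hat
  have hb := ENNReal.toReal_pos hb0 hbt
  rw [← ENNReal.ofReal_toReal hat, ← ENNReal.ofReal_toReal hbt,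
    ← ENNReal.ofReal_mul (Real.exp_pos c).le]
  refine ENNReal.ofReal_le_ofReal ?_
  calc a.toReal = Real.exp (Real.log a.toReal) := (Real.exp_log ha).symm
    _ ≤ Real.exp (c + Real.log b.toReal) := Real.exp_le_exp.2 (by linarith)
    _ = _ := by rw [Real.exp_add, Real.exp_log hb]

theorem log_toReal_div {a b : ℝ≥0∞} (ha0 : a ≠ 0) (hat : a ≠ ∞) (hb0 : b ≠ 0) (hbt : b ≠ ∞) :
    Real.log (a / b).toReal = Real.log a.toReal - Real.log b.toReal := by
  rw [ENNReal.toReal_div, Real.log_div (ENNReal.toReal_pos ha0 hat).ne'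
    (ENNReal.toReal_pos hb0 hbt).ne']

/-- A sequence of positive functions whose logarithms form a geometric Cauchy sequence converges. -/
theorem exists_limit_of_abs_log_div_le {S : Type*} [MeasurableSpace S] {f : ℕ → S → ℝ≥0∞}
    (hf : ∀ n, Measurable (f n)) (hf0 : ∀ n x, f n x ≠ 0) (hft : ∀ n x, f n x ≠ ∞) {K ρ : ℝ}
    (hρ1 : ρ < 1)
    (h : ∀ n x, |Real.log (f n x / f (n + 1) x).toReal| ≤ K * ρ ^ n) :
    ∃ g : S → ℝ≥0∞, Measurable g ∧ (∀ x, g x ≠ 0) ∧ (∀ x, g x ≠ ∞) ∧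
      ∀ n x, |Real.log (f n x).toReal - Real.log (g x).toReal| ≤ K / (1 - ρ) * ρ ^ n := by
  have hd : ∀ x n, dist (Real.log (f n x).toReal) (Real.log (f (n + 1) x).toReal) ≤ K * ρ ^ n := by
    intro x n
    rw [Real.dist_eq, ← log_toReal_div (hf0 _ _) (hft _ _) (hf0 _ _) (hft _ _)]
    exact h n x
  choose L hL using fun x => cauchySeq_tendsto_of_complete (cauchySeq_of_le_geometric ρ K hρ1 (hd x))
  have hLm : Measurable L := by
    refine measurable_of_tendsto_metrizable (f := fun n x => Real.log (f n x).toReal)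
      (fun n => (hf n).ennreal_toReal.log) (tendsto_pi_nhds.2 hL)
  refine ⟨fun x => ENNReal.ofReal (Real.exp (L x)), hLm.exp.ennreal_ofReal, fun x => ?_,
    fun x => ENNReal.ofReal_ne_top, fun n x => ?_⟩
  · exact (ENNReal.ofReal_pos.2 (Real.exp_pos _)).ne'
  · rw [ENNReal.toReal_ofReal (Real.exp_pos _).le, Real.log_exp, ← Real.dist_eq]
    refine (dist_le_of_le_geometric_of_tendsto ρ K hρ1 (hd x) (hL x) n).trans_eq ?_
    ring

/-- The normalisation passes to uniform logarithmic limits. -/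
theorem normalizer_eq_of_limit {X Y : Type*} [MeasurableSpace X] [MeasurableSpace Y]
    (μ : Measure X) {w : X → Y → ℝ≥0∞} {f : ℕ → X → ℝ≥0∞} {g : ℕ → Y → ℝ≥0∞}
    {f' : X → ℝ≥0∞} {g' : Y → ℝ≥0∞}
    (hf0 : ∀ n x, f n x ≠ 0) (hft : ∀ n x, f n x ≠ ∞) (hg0 : ∀ n x, g n x ≠ 0)
    (hgt : ∀ n x, g n x ≠ ∞) (hf0' : ∀ x, f' x ≠ 0) (hft' : ∀ x, f' x ≠ ∞) (hg0' : ∀ x, g' x ≠ 0)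
    (hgt' : ∀ x, g' x ≠ ∞) {c : ℕ → ℝ} (hc : Tendsto c atTop (𝓝 0))
    (hf : ∀ n x, |Real.log (f n x).toReal - Real.log (f' x).toReal| ≤ c n)
    (hg : ∀ n x, |Real.log (g n x).toReal - Real.log (g' x).toReal| ≤ c n)
    (hn : ∀ n, g n = normalizer μ w (f n)) : g' = normalizer μ w f' := by
  funext y
  have hn' : ∀ n, ∫⁻ x, w x y * f n x ∂μ = (g n y)⁻¹ := by
    intro n
    rw [hn n, normalizer, inv_inv]
  have e : ∀ n, ENNReal.ofReal (Real.exp (c n)) ≠ 0 := fun n =>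
    (ENNReal.ofReal_pos.2 (Real.exp_pos _)).ne'
  have inv_le : ∀ n {a b : ℝ≥0∞}, a ≤ ENNReal.ofReal (Real.exp (c n)) * b →
      b⁻¹ ≤ ENNReal.ofReal (Real.exp (c n)) * a⁻¹ := by
    intro n a b hab
    have h2 := ENNReal.inv_le_inv.2 hab
    rw [ENNReal.mul_inv (Or.inl (e n)) (Or.inl ENNReal.ofReal_ne_top)] at h2
    refine le_trans (le_of_eq ?_) (mul_le_mul_right h2 (ENNReal.ofReal (Real.exp (c n))))
    rw [← mul_assoc, ENNReal.mul_inv_cancel (e n) ENNReal.ofReal_ne_top, one_mul]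
  -- One factor `e^{c n}` replaces `f'` by `f n`, another replaces `g n` by `g'`. The square tends
  -- to one, so no dominated convergence is needed.
  have h1 : ∀ n, ∫⁻ x, w x y * f' x ∂μ ≤ ENNReal.ofReal (Real.exp (c n)) ^ 2 * (g' y)⁻¹ := by
    intro n
    calc ∫⁻ x, w x y * f' x ∂μ
        ≤ ∫⁻ x, ENNReal.ofReal (Real.exp (c n)) * (w x y * f n x) ∂μ := by
          refine lintegral_mono fun x => ?_
          have := le_ofReal_exp_mul_of_log_sub_log_le (hf0' x) (hft' x) (hf0 n x) (hft n x)
            (c := c n) (by linarith [(abs_le.1 (hf n x)).1])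
          exact (mul_le_mul_right this (w x y)).trans_eq (by ring)
      _ = ENNReal.ofReal (Real.exp (c n)) * (g n y)⁻¹ := by
          rw [lintegral_const_mul' _ _ ENNReal.ofReal_ne_top, hn']
      _ ≤ ENNReal.ofReal (Real.exp (c n)) * (ENNReal.ofReal (Real.exp (c n)) * (g' y)⁻¹) := by
          refine mul_le_mul_right (inv_le n ?_) _
          exact le_ofReal_exp_mul_of_log_sub_log_le (hg0' y) (hgt' y) (hg0 n y) (hgt n y)
            (by linarith [(abs_le.1 (hg n y)).1])
      _ = _ := by ring
  have h2 : ∀ n, (g' y)⁻¹ ≤ ENNReal.ofReal (Real.exp (c n)) ^ 2 * ∫⁻ x, w x y * f' x ∂μ := by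
    intro n
    calc (g' y)⁻¹ ≤ ENNReal.ofReal (Real.exp (c n)) * (g n y)⁻¹ :=
          inv_le n (le_ofReal_exp_mul_of_log_sub_log_le (hg0 n y) (hgt n y) (hg0' y) (hgt' y)
            (by linarith [(abs_le.1 (hg n y)).2]))
      _ = ENNReal.ofReal (Real.exp (c n)) * ∫⁻ x, w x y * f n x ∂μ := by rw [hn']
      _ ≤ ENNReal.ofReal (Real.exp (c n)) *
            ∫⁻ x, ENNReal.ofReal (Real.exp (c n)) * (w x y * f' x) ∂μ := by
          refine mul_le_mul_right (lintegral_mono fun x => ?_) _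
          have := le_ofReal_exp_mul_of_log_sub_log_le (hf0 n x) (hft n x) (hf0' x) (hft' x)
            (c := c n) (by linarith [(abs_le.1 (hf n x)).2])
          exact (mul_le_mul_right this (w x y)).trans_eq (by ring)
      _ = _ := by
          rw [lintegral_const_mul' _ _ ENNReal.ofReal_ne_top, ← mul_assoc, sq]
  have hlim : Tendsto (fun n => ENNReal.ofReal (Real.exp (c n)) ^ 2) atTop (𝓝 1) := by
    have : Tendsto (fun n => ENNReal.ofReal (Real.exp (c n) ^ 2)) atTop
        (𝓝 (ENNReal.ofReal (Real.exp 0 ^ 2))) :=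
      ENNReal.tendsto_ofReal (((Real.continuous_exp.tendsto 0).comp hc).pow 2)
    simpa [ENNReal.ofReal_pow (Real.exp_pos _).le] using this
  have l1 : ∫⁻ x, w x y * f' x ∂μ ≤ (g' y)⁻¹ := by
    have := ge_of_tendsto' (ENNReal.Tendsto.mul_const hlim (Or.inl one_ne_zero)) h1
    rwa [one_mul] at this
  have l2 : (g' y)⁻¹ ≤ ∫⁻ x, w x y * f' x ∂μ := by
    have := ge_of_tendsto' (ENNReal.Tendsto.mul_const hlim (Or.inl one_ne_zero)) h2
    rwa [one_mul] at this
  rw [normalizer, le_antisymm l1 l2, inv_inv]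

/-! ### Relative entropies of measures with densities -/

section Entropy

variable {S : Type*} [MeasurableSpace S]

theorem llr_withDensity (γ : Measure S) [SigmaFinite γ] {r : S → ℝ≥0∞} (hr : Measurable r) :
    llr (γ.withDensity r) γ =ᵐ[γ] fun x => Real.log (r x).toReal := by
  filter_upwards [Measure.rnDeriv_withDensity γ hr] with x hx
  rw [llr, hx]

theorem klDiv_withDensity_le (γ : Measure S) [IsProbabilityMeasure γ] {r : S → ℝ≥0∞}
    (hr : Measurable r) [IsProbabilityMeasure (γ.withDensity r)] {B : ℝ}
    (h : ∀ x, |Real.log (r x).toReal| ≤ B) :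
    klDiv (γ.withDensity r) γ ≤ ENNReal.ofReal B := by
  have hac : γ.withDensity r ≪ γ := withDensity_absolutelyContinuous _ _
  have hllr := hac.ae_eq (llr_withDensity γ hr)
  have hint : Integrable (fun x => Real.log (r x).toReal) (γ.withDensity r) :=
    Integrable.of_bound hr.ennreal_toReal.log.aestronglyMeasurable B (ae_of_all _ h)
  rw [klDiv_of_ac_of_integrable hac ((integrable_congr hllr).2 hint), integral_congr_ae hllr]
  simp only [probReal_univ, add_sub_cancel_right]
  refine ENNReal.ofReal_le_ofReal ?_
  calc _ ≤ ∫ _, B ∂(γ.withDensity r) :=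
        integral_mono hint (integrable_const B) fun x => (abs_le.1 (h x)).2
    _ = B := by simp

variable {X Y : Type*} [MeasurableSpace X] [MeasurableSpace Y]

theorem isProbabilityMeasure_of_mem_couplings {μ : Measure X} {η : Measure Y}
    [IsProbabilityMeasure μ] {P : Measure (X × Y)} (hP : P ∈ couplings μ η) :
    IsProbabilityMeasure P :=
  ⟨by rw [← Measure.fst_univ, hP.1, measure_univ]⟩

/-- A sum of functions of single variables sees only the marginals, so its integral is the same
under all couplings. This is the source of the Pythagorean identity. -/
theorem integrable_and_integral_add_of_mem_couplings {μ : Measure X} {η : Measure Y}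
    {P : Measure (X × Y)} (hP : P ∈ couplings μ η)
    {u : X → ℝ} {v : Y → ℝ} (hu : Integrable u μ) (hv : Integrable v η) :
    Integrable (fun p => u p.1 + v p.2) P ∧
      ∫ p, (u p.1 + v p.2) ∂P = ∫ x, u x ∂μ + ∫ y, v y ∂η := by
  obtain ⟨rfl, rfl⟩ := hP
  unfold Measure.fst at hu ⊢
  unfold Measure.snd at hv ⊢
  have hu' : Integrable (fun p : X × Y => u p.1) P := hu.comp_measurable measurable_fst
  have hv' : Integrable (fun p : X × Y => v p.2) P := hv.comp_measurable measurable_snd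
  refine ⟨hu'.add hv', ?_⟩
  rw [integral_add hu' hv', integral_map measurable_fst.aemeasurable hu.aestronglyMeasurable,
    integral_map measurable_snd.aemeasurable hv.aestronglyMeasurable]

/-- The Pythagorean identity for a coupling whose log-density splits into a sum of functions of the
two variables. -/
theorem klDiv_eq_add_of_log_density_split {μ : Measure X} {η : Measure Y} [IsProbabilityMeasure μ]
    {P₀ : Measure (X × Y)} [IsProbabilityMeasure P₀] {h : X × Y → ℝ≥0∞} (hh : Measurable h)
    (hh0 : ∀ p, h p ≠ 0) {u : X → ℝ} {v : Y → ℝ}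
    (hu : Integrable u μ) (hv : Integrable v η)
    (hlog : ∀ p, Real.log (h p).toReal = u p.1 + v p.2)
    (hP : P₀.withDensity h ∈ couplings μ η) {P : Measure (X × Y)} (hPc : P ∈ couplings μ η)
    (hfin : klDiv P P₀ ≠ ∞) :
    klDiv (P₀.withDensity h) P₀ ≠ ∞ ∧
      klDiv P P₀ = klDiv P (P₀.withDensity h) + klDiv (P₀.withDensity h) P₀ := by
  have hp1 := isProbabilityMeasure_of_mem_couplings hP
  have hp2 := isProbabilityMeasure_of_mem_couplings hPc
  have hac : P₀.withDensity h ≪ P₀ := withDensity_absolutelyContinuous _ _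
  have hac' : P₀ ≪ P₀.withDensity h :=
    withDensity_absolutelyContinuous' hh.aemeasurable (ae_of_all _ hh0)
  obtain ⟨hPac, hPint⟩ := klDiv_ne_top_iff.1 hfin
  have hPac' : P ≪ P₀.withDensity h := hPac.trans hac'
  have hl0 : llr (P₀.withDensity h) P₀ =ᵐ[P₀] fun p => u p.1 + v p.2 := by
    filter_upwards [llr_withDensity P₀ hh] with p hp
    rw [hp, hlog]
  obtain ⟨i1, s1⟩ := integrable_and_integral_add_of_mem_couplings hP hu hv
  obtain ⟨i2, s2⟩ := integrable_and_integral_add_of_mem_couplings hPc hu hv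
  have hfin1 : klDiv (P₀.withDensity h) P₀ ≠ ∞ :=
    klDiv_ne_top hac ((integrable_congr (hac.ae_eq hl0)).2 i1)
  -- The split term has the same integral under `P` as under `P₀.withDensity h`, where it is the
  -- relative entropy to `P₀`.
  have hchain : llr P P₀ =ᵐ[P] fun p => llr P (P₀.withDensity h) p + (u p.1 + v p.2) := by
    filter_upwards [hPac.ae_eq (Measure.rnDeriv_mul_rnDeriv (κ := P₀) hPac'), hPac.ae_eq hl0,
      Measure.rnDeriv_pos hPac', hPac'.ae_le (Measure.rnDeriv_lt_top P (P₀.withDensity h)),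
      hPac.ae_le (Measure.rnDeriv_withDensity P₀ hh), Measure.rnDeriv_pos hPac,
      hPac.ae_le (Measure.rnDeriv_lt_top P P₀)] with p h1 h2 h3 h4 h5 h6 h7
    rw [← h2]
    simp only [llr]
    rw [← h1, Pi.mul_apply, ENNReal.toReal_mul, Real.log_mul]
    · exact (ENNReal.toReal_pos h3.ne' h4.ne).ne'
    · rw [← h1, Pi.mul_apply] at h6 h7
      refine (ENNReal.toReal_pos (right_ne_zero_of_mul h6.ne') ?_).ne'
      intro htop
      rw [htop, ENNReal.mul_top h3.ne'] at h7
      exact lt_irrefl _ h7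
  have i3 : Integrable (llr P (P₀.withDensity h)) P := by
    have := ((integrable_congr hchain).1 hPint).sub i2
    refine this.congr (ae_of_all _ fun p => ?_)
    simp
  have hfin2 : klDiv P (P₀.withDensity h) ≠ ∞ := klDiv_ne_top hPac' i3
  refine ⟨hfin1, ?_⟩
  rw [← ENNReal.toReal_eq_toReal_iff' hfin (ENNReal.add_ne_top.2 ⟨hfin2, hfin1⟩),
    ENNReal.toReal_add hfin2 hfin1, toReal_klDiv_of_measure_eq hPac (by simp),
    toReal_klDiv_of_measure_eq hPac' (by simp), toReal_klDiv_of_measure_eq hac (by simp),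
    integral_congr_ae hchain, integral_add i3 i2, integral_congr_ae (hac.ae_eq hl0), s1, s2]

end Entropy

/-! ### The Schrödinger bridge -/

variable {X Y : Type*} [MeasurableSpace X] [StandardBorelSpace X] [Nonempty X]
  [MeasurableSpace Y] [StandardBorelSpace Y] [Nonempty Y]
  {μ : Measure X} [IsProbabilityMeasure μ] {η : Measure Y} [IsProbabilityMeasure η]
  {Q : Kernel X Y} [IsMarkovKernel Q] {w : X → Y → ℝ≥0∞} {κ : ℝ≥0} {b : Y → ℝ≥0∞}

/-- The limits of the potentials are normalizers of each other, which says that `a' w b'` has the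
right marginals. Its density relative to each even bridge factorizes over `x` and `y`, so it is
optimal by Pythagoras, provided the split log-density at index zero is integrable. -/
theorem IsComparable.exists_schrodingerBridge (hw : IsComparable w κ) (hb : IsPotential η b)
    (hQ : μ ⊗ₘ Q = (μ.prod η).withDensity fun p => potentialX μ η w b 0 p.1 * w p.1 p.2 * b p.2)
    (hex : ∃ P ∈ couplings μ η, klDiv P (μ ⊗ₘ Q) < ∞) :
    ∃ C : ℝ, ∃ P : Measure (X × Y), IsSchrodingerBridge μ η (μ ⊗ₘ Q) P ∧
      (∀ P', IsSchrodingerBridge μ η (μ ⊗ₘ Q) P' → P' = P) ∧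
      ∀ n : ℕ, klDiv P (bridgeEven μ η Q n) ≤
        ENNReal.ofReal (C * ((1 - ((κ : ℝ) ^ 2)⁻¹) ^ 2) ^ n) := by
  have pX : ∀ n, IsPotential μ (potentialX μ η w b n) := hw.isPotential_potentialX hb
  have pY : ∀ n, IsPotential η (potentialY μ η w b n) := hw.isPotential_potentialY hb
  have hδ1 : ((κ : ℝ) ^ 2)⁻¹ < 1 := by exact_mod_cast hw.inv_sq_lt_one
  have hδ0 : (0 : ℝ) < ((κ : ℝ) ^ 2)⁻¹ := by
    have : (0 : ℝ) < κ := by exact_mod_cast zero_lt_one.trans hw.one_lt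
    positivity
  set ρ : ℝ := (1 - ((κ : ℝ) ^ 2)⁻¹) ^ 2 with hρ
  have hρ0 : 0 < ρ := pow_pos (sub_pos.2 hδ1) 2
  have hρ1 : ρ < 1 := pow_lt_one₀ (sub_pos.2 hδ1).le (by linarith) two_ne_zero
  obtain ⟨a', ma', a0', at', ha'⟩ := exists_limit_of_abs_log_div_le
    (fun n => (pX n).measurable) (fun n => (pX n).ne_zero) (fun n => (pX n).ne_top) hρ1
    (hw.abs_log_potentialX_div_le hb)
  obtain ⟨b', mb', b0', bt', hb'⟩ := exists_limit_of_abs_log_div_le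
    (f := fun n => potentialY μ η w b (n + 1))
    (fun n => (pY _).measurable) (fun n => (pY _).ne_zero) (fun n => (pY _).ne_top) hρ1
    (hw.abs_log_potentialY_div_le hb)
  set c : ℝ := (κ : ℝ) ^ 2 / (1 - ρ) with hc
  have hc0 : 0 ≤ c := div_nonneg (by positivity) (by linarith)
  have hclim : Tendsto (fun n : ℕ => c * ρ ^ n) atTop (𝓝 0) := by
    simpa using (tendsto_pow_atTop_nhds_zero_of_lt_one hρ0.le hρ1).const_mul c
  have ha1' : ∀ n x, |Real.log (potentialX μ η w b (n + 1) x).toReal - Real.log (a' x).toReal| ≤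
      c * ρ ^ n := fun n x => (ha' (n + 1) x).trans (mul_le_mul_of_nonneg_left
        (pow_le_pow_of_le_one hρ0.le hρ1.le (Nat.le_succ _)) hc0)
  -- Here `a_n` is paired with `b_{n+1}`, and below `b_{n+1}` with `a_{n+1}`; the possibly unbounded
  -- `b_0` never enters.
  have eb : b' = normalizer μ w a' := normalizer_eq_of_limit μ
    (fun n => (pX n).ne_zero) (fun n => (pX n).ne_top) (fun n => (pY (n + 1)).ne_zero)
    (fun n => (pY (n + 1)).ne_top) a0' at' b0' bt' hclim ha' hb' fun n => rfl
  have ea : a' = normalizer η (fun y x => w x y) b' := normalizer_eq_of_limit η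
    (fun n => (pY (n + 1)).ne_zero) (fun n => (pY (n + 1)).ne_top)
    (fun n => (pX (n + 1)).ne_zero) (fun n => (pX (n + 1)).ne_top) b0' bt' a0' at' hclim hb' ha1'
    fun n => rfl
  set P : Measure (X × Y) := (μ.prod η).withDensity fun p => a' p.1 * w p.1 p.2 * b' p.2 with hPdef
  have hPc : P ∈ couplings μ η := by
    constructor
    · rw [hPdef, hw.fst_density μ η ma' mb', ← ea]
      simp_rw [ENNReal.div_self (a0' _) (at' _)]
      exact withDensity_one
    · rw [hPdef, hw.snd_density μ η ma' mb', ← eb]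
      simp_rw [ENNReal.div_self (b0' _) (bt' _)]
      exact withDensity_one
  have hPp := isProbabilityMeasure_of_mem_couplings hPc
  -- density of `P` with respect to the bridges
  set h : ℕ → X × Y → ℝ≥0∞ := fun n p =>
    a' p.1 / potentialX μ η w b n p.1 * (b' p.2 / potentialY μ η w b n p.2) with hh
  have hhm : ∀ n, Measurable (h n) := fun n =>
    ((ma'.div (pX n).measurable).comp measurable_fst).mul
      ((mb'.div (pY n).measurable).comp measurable_snd)
  have hX0 : ∀ n x, a' x / potentialX μ η w b n x ≠ 0 := fun n x =>
    ENNReal.div_ne_zero.2 ⟨a0' x, (pX n).ne_top x⟩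
  have hY0 : ∀ n y, b' y / potentialY μ η w b n y ≠ 0 := fun n y =>
    ENNReal.div_ne_zero.2 ⟨b0' y, (pY n).ne_top y⟩
  have hXt : ∀ n x, a' x / potentialX μ η w b n x ≠ ∞ := fun n x =>
    ENNReal.div_ne_top (at' x) ((pX n).ne_zero x)
  have hYt : ∀ n y, b' y / potentialY μ η w b n y ≠ ∞ := fun n y =>
    ENNReal.div_ne_top (bt' y) ((pY n).ne_zero y)
  have hPn : ∀ n, P = (bridgeEven μ η Q n).withDensity (h n) := by
    intro n
    rw [hw.bridgeEven_eq hb hQ, ← withDensity_mul _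
      (hw.measurable_density (pX n).measurable (pY n).measurable) (hhm n), hPdef]
    congr 1
    funext p
    simp only [Pi.mul_apply, hh]
    calc a' p.1 * w p.1 p.2 * b' p.2
        = (potentialX μ η w b n p.1 * (a' p.1 / potentialX μ η w b n p.1)) * w p.1 p.2 *
          (potentialY μ η w b n p.2 * (b' p.2 / potentialY μ η w b n p.2)) := by
          rw [ENNReal.mul_div_cancel ((pX n).ne_zero _) ((pX n).ne_top _),
            ENNReal.mul_div_cancel ((pY n).ne_zero _) ((pY n).ne_top _)]
      _ = _ := by ring
  have hlog : ∀ n p, Real.log (h n p).toReal =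
      (Real.log (a' p.1).toReal - Real.log (potentialX μ η w b n p.1).toReal) +
      (Real.log (b' p.2).toReal - Real.log (potentialY μ η w b n p.2).toReal) := by
    intro n p
    rw [← log_toReal_div (a0' _) (at' _) ((pX n).ne_zero _) ((pX n).ne_top _),
      ← log_toReal_div (b0' _) (bt' _) ((pY n).ne_zero _) ((pY n).ne_top _), hh,
      ENNReal.toReal_mul, Real.log_mul]
    · exact (ENNReal.toReal_pos (hX0 n _) (hXt n _)).ne'
    · exact (ENNReal.toReal_pos (hY0 n _) (hYt n _)).ne'
  have hbp : ∀ n, IsProbabilityMeasure (bridgeEven μ η Q n) := fun n => by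
    unfold bridgeEven; infer_instance
  -- integrability of the log-density on `Y`
  obtain ⟨P₁, hP₁, hP₁fin⟩ := hex
  have hP₁p := isProbabilityMeasure_of_mem_couplings hP₁
  have hu : Integrable (fun x => Real.log (a' x).toReal -
      Real.log (potentialX μ η w b 0 x).toReal) μ := by
    refine Integrable.of_bound
      (ma'.ennreal_toReal.log.sub (pX 0).measurable.ennreal_toReal.log).aestronglyMeasurable
      (c * ρ ^ 0) (ae_of_all _ fun x => ?_)
    rw [Real.norm_eq_abs, abs_sub_comm]
    exact ha' 0 x
  -- Split as `log (b' / b_1) + log (b_1 / b_0)`. The first term is bounded; the second is the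
  -- log-density of `η` relative to `π_0`, integrable because marginalization does not increase the
  -- finite entropy of `P₁`.
  have hv : Integrable (fun y => Real.log (b' y).toReal -
      Real.log (potentialY μ η w b 0 y).toReal) η := by
    have hπ : klDiv η (piEven μ η Q 0) ≠ ∞ := by
      have := klDiv_map_le (μ := P₁) (ν := μ ⊗ₘ Q) (measurable_snd (α := X) (β := Y))
      change klDiv P₁.snd (μ ⊗ₘ Q).snd ≤ _ at this
      rw [hP₁.2, Measure.snd_compProd] at this
      exact (this.trans_lt hP₁fin).ne
    have hllr := (klDiv_ne_top_iff.1 hπ).2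
    have hac := (klDiv_ne_top_iff.1 hπ).1
    have hπp : IsProbabilityMeasure (piEven μ η Q 0) := by unfold piEven; infer_instance
    have e2 : (piEven μ η Q 0).withDensity
        (fun y => potentialY μ η w b 1 y / potentialY μ η w b 0 y) = η := by
      rw [hw.piEven_eq hb hQ, withDensity_div_withDensity_div _ (pY 0).measurable
        (pY 1).measurable (pY 0).ne_zero (pY 0).ne_top (pY 1).ne_zero (pY 1).ne_top]
    have e3 := llr_withDensity (piEven μ η Q 0) ((pY 1).measurable.div (pY 0).measurable)
    change llr ((piEven μ η Q 0).withDensity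
      fun y => potentialY μ η w b 1 y / potentialY μ η w b 0 y) _ =ᵐ[_] _ at e3
    rw [e2] at e3
    have i1 := (integrable_congr (hac.ae_eq e3)).1 hllr
    have i2 : Integrable (fun y => Real.log (b' y).toReal -
        Real.log (potentialY μ η w b 1 y).toReal) η := by
      refine Integrable.of_bound
        (mb'.ennreal_toReal.log.sub (pY 1).measurable.ennreal_toReal.log).aestronglyMeasurable
        (c * ρ ^ 0) (ae_of_all _ fun y => ?_)
      rw [Real.norm_eq_abs, abs_sub_comm]
      exact hb' 0 y
    refine (i2.add i1).congr (ae_of_all _ fun y => ?_)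
    simp only [Pi.add_apply, Pi.div_apply]
    rw [log_toReal_div ((pY 1).ne_zero _) ((pY 1).ne_top _) ((pY 0).ne_zero _) ((pY 0).ne_top _)]
    ring
  have hP0 : P = (μ ⊗ₘ Q).withDensity (h 0) := hPn 0
  have pyth : ∀ P' ∈ couplings μ η, klDiv P' (μ ⊗ₘ Q) ≠ ∞ →
      klDiv P (μ ⊗ₘ Q) ≠ ∞ ∧ klDiv P' (μ ⊗ₘ Q) = klDiv P' P + klDiv P (μ ⊗ₘ Q) := by
    intro P' hP' hfin
    have hmem : (μ ⊗ₘ Q).withDensity (h 0) ∈ couplings μ η := hP0 ▸ hPc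
    have := klDiv_eq_add_of_log_density_split (hhm 0)
      (fun p => mul_ne_zero (hX0 0 _) (hY0 0 _)) hu hv (hlog 0) hmem hP' hfin
    rwa [← hP0] at this
  have hPfin : klDiv P (μ ⊗ₘ Q) ≠ ∞ := (pyth P₁ hP₁ hP₁fin.ne).1
  have hPmin : IsSchrodingerBridge μ η (μ ⊗ₘ Q) P := by
    refine ⟨hPc, fun P' hP' => ?_⟩
    by_cases hfin : klDiv P' (μ ⊗ₘ Q) = ∞
    · rw [hfin]; exact le_top
    · rw [(pyth P' hP' hfin).2]; exact le_add_self
  -- The first entry covers `n = 0`, where the log-density may be unbounded. At `n + 1` the two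
  -- potentials contribute `c * ρ ^ n` each, whence `2 * c / ρ`.
  refine ⟨max (klDiv P (μ ⊗ₘ Q)).toReal (2 * c / ρ), P, hPmin, fun P' hP' => ?_, fun n => ?_⟩
  · have hle := hP'.2 P hPc
    have hP'p := isProbabilityMeasure_of_mem_couplings hP'.1
    have heq := (pyth P' hP'.1 (hle.trans_lt hPfin.lt_top).ne).2
    rw [heq] at hle
    have h0 : klDiv P' P = 0 := by
      have h1 : klDiv P' P + klDiv P (μ ⊗ₘ Q) ≤ 0 + klDiv P (μ ⊗ₘ Q) := by rwa [zero_add]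
      exact le_antisymm ((ENNReal.add_le_add_iff_right hPfin).1 h1) bot_le
    exact klDiv_eq_zero_iff.1 h0
  · cases n with
    | zero =>
      rw [pow_zero, mul_one]
      change klDiv P (μ ⊗ₘ Q) ≤ _
      exact (ENNReal.ofReal_toReal hPfin).symm.le.trans
        (ENNReal.ofReal_le_ofReal (le_max_left _ _))
    | succ n =>
      have hp : IsProbabilityMeasure ((bridgeEven μ η Q (n + 1)).withDensity (h (n + 1))) :=
        hPn (n + 1) ▸ hPp
      have hle := klDiv_withDensity_le (bridgeEven μ η Q (n + 1)) (hhm (n + 1))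
        (B := c * ρ ^ n + c * ρ ^ n) fun p => by
          rw [hlog]
          refine (abs_add_le _ _).trans (add_le_add ?_ ?_)
          · rw [abs_sub_comm]; exact ha1' n p.1
          · rw [abs_sub_comm]; exact hb' n p.2
      rw [← hPn] at hle
      refine hle.trans (ENNReal.ofReal_le_ofReal ?_)
      calc c * ρ ^ n + c * ρ ^ n = 2 * c / ρ * ρ ^ (n + 1) := by field_simp; ring
        _ ≤ _ := mul_le_mul_of_nonneg_right (le_max_right _ _) (by positivity)

end Sinkhorn

/-! ### The reference model with bounded `W`, and the assembly of the theorem. -/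

namespace Sinkhorn

variable {X Y : Type*} [MeasurableSpace X] [MeasurableSpace Y]

/-- Two values of `W` differ by at most `2 * C`; strict positivity of `C` is what makes `κ > 1`. -/
theorem isComparable_exp_neg {W : X → Y → ℝ} (hW : Measurable (Function.uncurry W)) {C : ℝ}
    (hC : 0 < C) (h : ∀ x y, |W x y| ≤ C) :
    IsComparable (fun x y => ENNReal.ofReal (Real.exp (-W x y))) (Real.exp (2 * C)).toNNReal := by
  have key : ∀ {s t : ℝ}, |s| ≤ C → |t| ≤ C → ENNReal.ofReal (Real.exp (-s)) ≤
      ((Real.exp (2 * C)).toNNReal : ℝ≥0∞) * ENNReal.ofReal (Real.exp (-t)) := by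
    intro s t hs ht
    change _ ≤ ENNReal.ofReal _ * _
    rw [← ENNReal.ofReal_mul (Real.exp_pos _).le, ← Real.exp_add]
    refine ENNReal.ofReal_le_ofReal (Real.exp_le_exp.2 ?_)
    linarith [(abs_le.1 hs).1, (abs_le.1 ht).2]
  exact
    { measurable := hW.neg.exp.ennreal_ofReal
      ne_zero := fun x y => (ENNReal.ofReal_pos.2 (Real.exp_pos _)).ne'
      ne_top := fun x y => ENNReal.ofReal_ne_top
      le_left := fun x x' y => key (h x y) (h x' y)
      le_right := fun x y y' => key (h x y) (h x y')
      one_lt := Real.one_lt_toNNReal.2 (Real.one_lt_exp_iff.2 (by linarith)) }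

theorem gibbs_withDensity_exp (nu : Measure Y) {V : Y → ℝ} (hV : Measurable V) :
    (gibbs nu V).withDensity (fun y => ENNReal.ofReal (Real.exp (V y))) = nu := by
  unfold gibbs
  rw [← withDensity_mul _ (f := fun y => ENNReal.ofReal (Real.exp (-V y))) (by fun_prop)
    (by fun_prop)]
  refine Eq.trans ?_ (withDensity_one (μ := nu))
  congr 1
  funext y
  simp only [Pi.mul_apply, Pi.one_apply]
  rw [← ENNReal.ofReal_mul (Real.exp_pos _).le, ← Real.exp_add, neg_add_cancel, Real.exp_zero,
    ENNReal.ofReal_one]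

theorem refKernel_apply_eq (nu : Measure Y) [SFinite nu] {W : X → Y → ℝ}
    (hW : Measurable (Function.uncurry W)) (x : X) :
    refKernel nu W x = nu.withDensity fun y => ENNReal.ofReal (Real.exp (-W x y)) := by
  unfold refKernel
  rw [Kernel.withDensity_apply _ hW.neg.exp.ennreal_ofReal, Kernel.const_apply]

/-- The function `e^V` is a potential; in particular the reference measure `nu` is finite. -/
theorem isPotential_exp (nu : Measure Y) [SFinite nu] {V : Y → ℝ} (hV : Measurable V)
    {W : X → Y → ℝ} (hW : Measurable (Function.uncurry W)) [IsMarkovKernel (refKernel nu W)]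
    [Nonempty X] {C : ℝ} (h : ∀ x y, |W x y| ≤ C) :
    IsPotential (gibbs nu V) (fun y => ENNReal.ofReal (Real.exp (V y))) where
  measurable := hV.exp.ennreal_ofReal
  ne_zero y := (ENNReal.ofReal_pos.2 (Real.exp_pos _)).ne'
  ne_top y := ENNReal.ofReal_ne_top
  lintegral_ne_top := by
    obtain ⟨x⟩ := ‹Nonempty X›
    have h1 : ∫⁻ y, ENNReal.ofReal (Real.exp (-W x y)) ∂nu = 1 := by
      have := measure_univ (μ := refKernel nu W x)
      rwa [refKernel_apply_eq nu hW, withDensity_apply _ MeasurableSet.univ,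
        Measure.restrict_univ] at this
    -- A probability density bounded below by `e^{-C}` forces `nu` to be finite, and its mass is the
    -- integral of `e^V`.
    have h2 : ENNReal.ofReal (Real.exp (-C)) * nu Set.univ ≤ 1 := by
      rw [← h1, ← lintegral_const]
      refine lintegral_mono fun y => ENNReal.ofReal_le_ofReal (Real.exp_le_exp.2 ?_)
      linarith [(abs_le.1 (h x y)).2]
    have h3 : ∫⁻ y, ENNReal.ofReal (Real.exp (V y)) ∂gibbs nu V = nu Set.univ := by
      conv_rhs => rw [← gibbs_withDensity_exp nu hV]
      rw [withDensity_apply _ MeasurableSet.univ, Measure.restrict_univ]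
    rw [h3]
    intro htop
    rw [htop, ENNReal.mul_top (ENNReal.ofReal_pos.2 (Real.exp_pos _)).ne'] at h2
    exact absurd h2 (by simp)

/-- The reference measure in terms of the initial potentials. -/
theorem compProd_refKernel_eq (μ : Measure X) [IsProbabilityMeasure μ] (nu : Measure Y)
    [SFinite nu] {V : Y → ℝ} (hV : Measurable V) [IsProbabilityMeasure (gibbs nu V)]
    {W : X → Y → ℝ} (hW : Measurable (Function.uncurry W)) [IsMarkovKernel (refKernel nu W)] :
    μ ⊗ₘ refKernel nu W = (μ.prod (gibbs nu V)).withDensity fun p =>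
      potentialX μ (gibbs nu V) (fun x y => ENNReal.ofReal (Real.exp (-W x y)))
        (fun y => ENNReal.ofReal (Real.exp (V y))) 0 p.1 *
        ENNReal.ofReal (Real.exp (-W p.1 p.2)) * ENNReal.ofReal (Real.exp (V p.2)) := by
  have hWx : ∀ x, Measurable (W x) := fun x => hW.comp measurable_prodMk_left
  have hWm : Measurable fun p : X × Y => W p.1 p.2 := hW
  have hchange : ∀ {g : Y → ℝ≥0∞}, Measurable g →
      ∫⁻ y, g y ∂nu = ∫⁻ y, g y * ENNReal.ofReal (Real.exp (V y)) ∂gibbs nu V := by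
    intro g hg
    conv_lhs => rw [← gibbs_withDensity_exp nu hV]
    rw [lintegral_withDensity_eq_lintegral_mul _ (by fun_prop) hg]
    simp [mul_comm]
  -- The Markov property of the reference kernel is exactly the normalization `a_0 = 1`.
  have h0 : ∀ x, potentialX μ (gibbs nu V) (fun x y => ENNReal.ofReal (Real.exp (-W x y)))
      (fun y => ENNReal.ofReal (Real.exp (V y))) 0 x = 1 := by
    intro x
    have := measure_univ (μ := refKernel nu W x)
    rw [refKernel_apply_eq nu hW, withDensity_apply _ MeasurableSet.univ,
      Measure.restrict_univ, hchange (by fun_prop)] at this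
    unfold potentialX normalizer potentialY
    rw [this, inv_one]
  simp_rw [h0, one_mul]
  refine Measure.ext_of_lintegral _ fun g hg => ?_
  rw [Measure.lintegral_compProd hg, lintegral_withDensity_eq_lintegral_mul _ (by fun_prop) hg,
    lintegral_prod _ (by fun_prop)]
  refine lintegral_congr fun x => ?_
  rw [refKernel_apply_eq nu hW, lintegral_withDensity_eq_lintegral_mul _ (by fun_prop)
    (by fun_prop), hchange (by fun_prop)]
  refine lintegral_congr fun y => ?_
  simp only [Pi.mul_apply]
  ring

/-- If the logarithm of the initial potential is bounded, then so is the first log-density. -/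
theorem IsComparable.exists_abs_log_potentialY_zero_div_le {μ : Measure X}
    [IsProbabilityMeasure μ] {η : Measure Y} [IsProbabilityMeasure η] {w : X → Y → ℝ≥0∞} {κ : ℝ≥0}
    {b : Y → ℝ≥0∞} (hw : IsComparable w κ) (hb : IsPotential η b) {M : ℝ} (hM : ∀ᵐ y ∂η, |Real.log (b y).toReal| ≤ M) :
    ∃ B : ℝ, ∀ᵐ y ∂η,
      |Real.log (potentialY μ η w b 0 y / potentialY μ η w b 1 y).toReal| ≤ B := by
  have p := hw.isPotential_potentialY (μ := μ) hb 1
  obtain ⟨y₀⟩ := nonempty_of_isProbabilityMeasure η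
  refine ⟨M + (|Real.log (potentialY μ η w b 1 y₀).toReal| + Real.log κ), ?_⟩
  have hκ : (0 : ℝ) < κ := by exact_mod_cast zero_lt_one.trans hw.one_lt
  have hle : ∀ y y', Real.log (potentialY μ η w b 1 y).toReal ≤
      Real.log κ + Real.log (potentialY μ η w b 1 y').toReal := by
    intro y y'
    have h := hw.potentialY_succ_le (μ := μ) (η := η) (b := b) 0 y y'
    have h' := ENNReal.toReal_mono (ENNReal.mul_ne_top ENNReal.coe_ne_top (p.ne_top y')) h
    rw [ENNReal.toReal_mul, ENNReal.coe_toReal] at h'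
    rw [← Real.log_mul hκ.ne' (ENNReal.toReal_pos (p.ne_zero y') (p.ne_top y')).ne']
    exact Real.log_le_log (ENNReal.toReal_pos (p.ne_zero y) (p.ne_top y)) h'
  filter_upwards [hM] with y hy
  change |Real.log (b y / _).toReal| ≤ _
  rw [log_toReal_div (hb.ne_zero y) (hb.ne_top y) (p.ne_zero y) (p.ne_top y)]
  refine (abs_sub _ _).trans (add_le_add hy ?_)
  rw [abs_le]
  constructor
  · linarith [hle y₀ y, neg_abs_le (Real.log (potentialY μ η w b 1 y₀).toReal)]
  · linarith [hle y y₀, le_abs_self (Real.log (potentialY μ η w b 1 y₀).toReal)]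

variable [StandardBorelSpace X] [Nonempty X] [StandardBorelSpace Y] [Nonempty Y]
  {μ : Measure X} [IsProbabilityMeasure μ] {η : Measure Y} [IsProbabilityMeasure η]
  {Q : Kernel X Y} [IsMarkovKernel Q] {w : X → Y → ℝ≥0∞} {κ : ℝ≥0} {b : Y → ℝ≥0∞}

namespace IsComparable

theorem logDensityBound_piOdd (hw : IsComparable w κ) (hb : IsPotential η b)
    (hQ : μ ⊗ₘ Q = (μ.prod η).withDensity fun p => potentialX μ η w b 0 p.1 * w p.1 p.2 * b p.2)
    (n : ℕ) {B : ℝ} (hB : (κ : ℝ) ^ 2 * ((1 - ((κ : ℝ) ^ 2)⁻¹) ^ 2) ^ n ≤ B) :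
    LogDensityBound μ (piOdd μ η Q n) B ∧ LogDensityBound (piOdd μ η Q n) μ B := by
  have p := hw.isPotential_potentialX (μ := μ) hb n
  have p' := hw.isPotential_potentialX (μ := μ) hb (n + 1)
  rw [hw.piOdd_eq hb hQ]
  exact (logDensityBound_withDensity μ (p.measurable.div p'.measurable)
    (fun x => ENNReal.div_ne_zero.2 ⟨p.ne_zero x, p'.ne_top x⟩)
    (fun x => ENNReal.div_ne_top (p.ne_top x) (p'.ne_zero x))
    (ae_of_all _ fun x => (hw.abs_log_potentialX_div_le hb n x).trans hB)).symm

theorem logDensityBound_piEven (hw : IsComparable w κ) (hb : IsPotential η b)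
    (hQ : μ ⊗ₘ Q = (μ.prod η).withDensity fun p => potentialX μ η w b 0 p.1 * w p.1 p.2 * b p.2)
    (n : ℕ) {B : ℝ}
    (hB : ∀ᵐ y ∂η, |Real.log (potentialY μ η w b n y / potentialY μ η w b (n + 1) y).toReal| ≤ B) :
    LogDensityBound (piEven μ η Q n) η B ∧ LogDensityBound η (piEven μ η Q n) B := by
  have p := hw.isPotential_potentialY (μ := μ) hb n
  have p' := hw.isPotential_potentialY (μ := μ) hb (n + 1)
  rw [hw.piEven_eq hb hQ]
  exact logDensityBound_withDensity η (p.measurable.div p'.measurable)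
    (fun x => ENNReal.div_ne_zero.2 ⟨p.ne_zero x, p'.ne_top x⟩)
    (fun x => ENNReal.div_ne_top (p.ne_top x) (p'.ne_zero x)) hB

end IsComparable

end Sinkhorn

theorem theorem2p1 {X Y : Type*}
    [TopologicalSpace X] [PolishSpace X] [LocallyCompactSpace X] [MeasurableSpace X]
    [BorelSpace X] [Nonempty X]
    [TopologicalSpace Y] [PolishSpace Y] [LocallyCompactSpace Y] [MeasurableSpace Y]
    [BorelSpace Y] [Nonempty Y]
    (lam : Measure X) [IsLocallyFiniteMeasure lam] (nu : Measure Y) [IsLocallyFiniteMeasure nu]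
    (U : X → ℝ) (hU : Measurable U) (V : Y → ℝ) (hV : Measurable V)
    (W : X → Y → ℝ) (hW : Measurable (Function.uncurry W))
    [IsProbabilityMeasure (gibbs lam U)] [IsProbabilityMeasure (gibbs nu V)]
    [IsMarkovKernel (refKernel nu W)]
    (hWb : ∃ C : ℝ, ∀ x y, |W x y| ≤ C)
    (Φ : ℝ≥0 → ℝ≥0 → EReal) (hΦ : IsEntropyFunction Φ) :
    ∃ ρ c : ℝ, 0 < ρ ∧ ρ < 1 ∧ 0 < c ∧
      -- contraction of the entropies
      (∀ n : ℕ,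
        phiEntropy Φ (piEven (gibbs lam U) (gibbs nu V) (refKernel nu W) n) (gibbs nu V) ≤
          ((ρ ^ n : ℝ) : EReal) *
            phiEntropy Φ (piEven (gibbs lam U) (gibbs nu V) (refKernel nu W) 0) (gibbs nu V) ∧
        phiEntropy Φ (gibbs nu V) (piEven (gibbs lam U) (gibbs nu V) (refKernel nu W) n) ≤
          ((ρ ^ n : ℝ) : EReal) *
            phiEntropy Φ (gibbs nu V) (piEven (gibbs lam U) (gibbs nu V) (refKernel nu W) 0) ∧
        phiEntropy Φ (gibbs lam U) (piOdd (gibbs lam U) (gibbs nu V) (refKernel nu W) n) ≤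
          ((ρ ^ n : ℝ) : EReal) *
            phiEntropy Φ (gibbs lam U) (piOdd (gibbs lam U) (gibbs nu V) (refKernel nu W) 0) ∧
        phiEntropy Φ (piOdd (gibbs lam U) (gibbs nu V) (refKernel nu W) n) (gibbs lam U) ≤
          ((ρ ^ n : ℝ) : EReal) *
            phiEntropy Φ (piOdd (gibbs lam U) (gibbs nu V) (refKernel nu W) 0) (gibbs lam U)) ∧
      -- uniform decay of the log-densities
      (∀ n : ℕ, (1 ≤ n ∨ ∃ M : ℝ, ∀ᵐ y ∂nu, |V y| ≤ M) →
        LogDensityBound (piEven (gibbs lam U) (gibbs nu V) (refKernel nu W) n) (gibbs nu V) (c * ρ ^ n) ∧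
        LogDensityBound (gibbs nu V) (piEven (gibbs lam U) (gibbs nu V) (refKernel nu W) n) (c * ρ ^ n)) ∧
      (∀ n : ℕ,
        LogDensityBound (gibbs lam U) (piOdd (gibbs lam U) (gibbs nu V) (refKernel nu W) n) (c * ρ ^ n) ∧
        LogDensityBound (piOdd (gibbs lam U) (gibbs nu V) (refKernel nu W) n) (gibbs lam U) (c * ρ ^ n)) ∧
      -- entropic convergence to the (unique) Schrödinger bridge
      ((∃ P ∈ couplings (gibbs lam U) (gibbs nu V), InformationTheory.klDiv P
          (gibbs lam U ⊗ₘ refKernel nu W) < ⊤) →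
        ∃ P : Measure (X × Y),
          IsSchrodingerBridge (gibbs lam U) (gibbs nu V) (gibbs lam U ⊗ₘ refKernel nu W) P ∧
          (∀ P', IsSchrodingerBridge (gibbs lam U) (gibbs nu V) (gibbs lam U ⊗ₘ refKernel nu W) P' → P' = P) ∧
          ∀ n : ℕ, InformationTheory.klDiv P (bridgeEven (gibbs lam U) (gibbs nu V) (refKernel nu W) n) ≤
            ENNReal.ofReal (c * ρ ^ n)) := by

  obtain ⟨C, hC, hWC⟩ : ∃ C : ℝ, 0 < C ∧ ∀ x y, |W x y| ≤ C := by
    obtain ⟨C, hC⟩ := hWb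
    -- Enlarging the bound gives `κ > 1`, hence `ρ > 0`, even when `W` vanishes.
    exact ⟨max C 1, by positivity, fun x y => (hC x y).trans (le_max_left _ _)⟩
  have hw := isComparable_exp_neg hW hC hWC
  set κ : ℝ≥0 := (Real.exp (2 * C)).toNNReal
  have hb := isPotential_exp nu hV hW hWC
  have hQ := compProd_refKernel_eq (gibbs lam U) nu hV hW
  have hδ1 : ((κ : ℝ) ^ 2)⁻¹ < 1 := by exact_mod_cast hw.inv_sq_lt_one
  have hκ0 : (0 : ℝ) < κ := by exact_mod_cast zero_lt_one.trans hw.one_lt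
  have hδ0 : (0 : ℝ) < ((κ : ℝ) ^ 2)⁻¹ := by positivity
  set ρ : ℝ := (1 - ((κ : ℝ) ^ 2)⁻¹) ^ 2 with hρ
  have hρ0 : 0 < ρ := pow_pos (sub_pos.2 hδ1) 2
  have hρ1 : ρ < 1 := pow_lt_one₀ (sub_pos.2 hδ1).le (by linarith) two_ne_zero
  -- `B`, like `D` below, is chosen before its hypothesis is assumed, so that one `c` serves all the
  -- conditional claims.
  obtain ⟨B, hB⟩ : ∃ B : ℝ, (∃ M : ℝ, ∀ᵐ y ∂nu, |V y| ≤ M) → ∀ᵐ y ∂(gibbs nu V),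
      |Real.log (potentialY (gibbs lam U) (gibbs nu V)
          (fun x y => ENNReal.ofReal (Real.exp (-W x y)))
          (fun y => ENNReal.ofReal (Real.exp (V y))) 0 y /
        potentialY (gibbs lam U) (gibbs nu V) (fun x y => ENNReal.ofReal (Real.exp (-W x y)))
          (fun y => ENNReal.ofReal (Real.exp (V y))) 1 y).toReal| ≤ B := by
    by_cases hM : ∃ M : ℝ, ∀ᵐ y ∂nu, |V y| ≤ M
    · obtain ⟨M, hM⟩ := hM
      have hM' : ∀ᵐ y ∂(gibbs nu V), |Real.log (ENNReal.ofReal (Real.exp (V y))).toReal| ≤ M := by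
        filter_upwards [(withDensity_absolutelyContinuous nu _).ae_le hM] with y hy
        rwa [ENNReal.toReal_ofReal (Real.exp_pos _).le, Real.log_exp]
      obtain ⟨B, hB⟩ := hw.exists_abs_log_potentialY_zero_div_le (μ := gibbs lam U) hb hM'
      exact ⟨B, fun _ => hB⟩
    · exact ⟨0, fun h => absurd h hM⟩
  obtain ⟨D, hD⟩ : ∃ D : ℝ, (∃ P ∈ couplings (gibbs lam U) (gibbs nu V),
      InformationTheory.klDiv P (gibbs lam U ⊗ₘ refKernel nu W) < ⊤) →
      ∃ P : Measure (X × Y),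
        IsSchrodingerBridge (gibbs lam U) (gibbs nu V) (gibbs lam U ⊗ₘ refKernel nu W) P ∧
        (∀ P', IsSchrodingerBridge (gibbs lam U) (gibbs nu V)
          (gibbs lam U ⊗ₘ refKernel nu W) P' → P' = P) ∧
        ∀ n : ℕ, InformationTheory.klDiv P
          (bridgeEven (gibbs lam U) (gibbs nu V) (refKernel nu W) n) ≤
            ENNReal.ofReal (D * ρ ^ n) := by
    by_cases hex : ∃ P ∈ couplings (gibbs lam U) (gibbs nu V),
        InformationTheory.klDiv P (gibbs lam U ⊗ₘ refKernel nu W) < ⊤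
    · obtain ⟨D, hD⟩ := hw.exists_schrodingerBridge hb hQ hex
      exact ⟨D, fun _ => hD⟩
    · exact ⟨0, fun h => absurd h hex⟩
  have hK : 0 < (κ : ℝ) ^ 2 / ρ := by positivity
  have hKle : (κ : ℝ) ^ 2 ≤ (κ : ℝ) ^ 2 / ρ := le_div_self (by positivity) hρ0 hρ1.le
  -- The division by `ρ` pays for the index shift on `Y`, where the bound at `n + 1` is `κ ^ 2 * ρ ^
  -- n`; `B` covers `n = 0` there, and `D` the Schrödinger bridge.
  set c : ℝ := (κ : ℝ) ^ 2 / ρ + |B| + |D|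
  have hcK : (κ : ℝ) ^ 2 / ρ ≤ c := by
    linarith [abs_nonneg B, abs_nonneg D, show c = (κ : ℝ) ^ 2 / ρ + |B| + |D| from rfl]
  have hcB : B ≤ c := by
    linarith [le_abs_self B, abs_nonneg D, show c = (κ : ℝ) ^ 2 / ρ + |B| + |D| from rfl]
  have hcD : D ≤ c := by
    linarith [abs_nonneg B, le_abs_self D, show c = (κ : ℝ) ^ 2 / ρ + |B| + |D| from rfl]
  refine ⟨ρ, c, hρ0, hρ1, by linarith, hw.phiEntropy_iterates_le hb hQ hΦ, fun n hn => ?_,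
    fun n => ?_, fun hex => ?_⟩
  · refine hw.logDensityBound_piEven hb hQ n ?_
    cases n with
    | zero =>
      filter_upwards [hB (hn.resolve_left (by simp))] with y hy
      rw [pow_zero, mul_one]
      exact hy.trans hcB
    | succ n =>
      refine ae_of_all _ fun y => (hw.abs_log_potentialY_div_le hb n y).trans ?_
      calc (κ : ℝ) ^ 2 * ρ ^ n = (κ : ℝ) ^ 2 / ρ * ρ ^ (n + 1) := by field_simp; ring
        _ ≤ c * ρ ^ (n + 1) := mul_le_mul_of_nonneg_right hcK (by positivity)
  · exact hw.logDensityBound_piOdd hb hQ n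
      (mul_le_mul_of_nonneg_right (hKle.trans hcK) (by positivity))
  · obtain ⟨P, h1, h2, h3⟩ := hD hex
    exact ⟨P, h1, h2, fun n => (h3 n).trans (ENNReal.ofReal_le_ofReal
      (mul_le_mul_of_nonneg_right hcD (by positivity)))⟩
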